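/- A \emph{product-coproduct prograph} is a planar assembly, with one input and one output, of nodes of two types: coproducts (one input, two outputs) and products (two inputs, one output); in other words, an endomorphism of the object $1$ in the free PRO (strict monoidal category with objects $\mathbb{N}$) generated by one operator $1\to 2$ and one operator $2\to 1$. Let $PC(n)$ be the set of prographs with $n$ coproducts and $n$ products, and $PC=\bigcup_{n\in\mathbb{N}}PC(n)$, a monoid under stacking: in $p\cdot q$ the output of $p$ is grafted with the input of $q$. Let $ST_{\langle n^3\rangle}$ be the set of standard Young tableaux of shape $(n,n,n)$ and $ST=\bigcup_{n\in\mathbb{N}}ST_{\langle n^3\rangle}$, a monoid under shifted concatenation: if $T\in ST_{\langle n^3\rangle}$, then $T\bullet U$ is obtained by adding $3n$ to all entries of $U$ and appending each row to the corresponding row of $T$. The map $le: PC\to ST$ is defined as follows. Number the wires of a prograph $1,2,3,\dots$ in the order of the depth-left first search from the input: after a wire that enters a coproduct, search from the left output of this coproduct, then from its right output; after a wire that is the right input of a product, search from the output of this product; at a left input of a product, stop and backtrack. The first (bottom), second and third row of $le(p)$ consist of the labels of the inputs of coproducts, of the left inputs of products, and of the right inputs of products, respectively. For a monoid $M$ call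 $m \in M$ indecomposable if it is not a unit and not a product of two non-units. \textbf{Proposition.} The map $le$ is a bijection, and it maps $PC(n)$ bijectively onto $ST_{\langle n^3\rangle}$ for every $n$. Let $\mathbb{K}$ be a field. For $M=PC$ and for $M=ST$ there is exactly one Hopf algebra structure on the monoid algebra $\mathbb{K}[M]$ (with its usual algebra structure) for which every indecomposable $m\in M$ is primitive, $\Delta(m)=m\otimes 1+1\otimes m$. It is graded by the subspaces spanned by $PC(n)$, respectively by $ST_{\langle n^3\rangle}$, $n\in\mathbb{N}$. With these structures the linear extension of $le$ is an isomorphism of graded Hopf algebras $\mathbb{K}[PC]\to\mathbb{K}[ST]$: a bijective linear map compatible with products, units, coproducts, counits and antipodes, that maps the span of $PC(n)$ onto the span of $ST_{\langle n^3\rangle}$ for every $n$. -/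

import Mathlib

open scoped TensorProduct

/-! ### Product-coproduct prographs: the free PRO on `1 → 2` and `2 → 1` -/

/-- Formal expressions with `a` inputs and `b` outputs built from the identities, one coproduct
`1 → 2` and one product `2 → 1`. `comp f g` is `f` with `g` stacked on top of it (the outputs of
`f` are grafted on the inputs of `g`), `tens f g` is `f` drawn to the left of `g`. -/
inductive PCExpr : ℕ → ℕ → Type
  | idn (n : ℕ) : PCExpr n n
  | cop : PCExpr 1 2
  | prod : PCExpr 2 1
  | comp {a b c : ℕ} (f : PCExpr a b) (g : PCExpr b c) : PCExpr a c
  | tens {a b c d : ℕ} (f : PCExpr a b) (g : PCExpr c d) : PCExpr (a + c) (b + d)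

namespace PCExpr

/-- Two expressions denote the same planar assembly (the same morphism of the free PRO): the
congruence generated by the axioms of strict monoidal categories. It is heterogeneous in the
numbers of inputs and outputs only because `(a + c) + e` and `a + (c + e)` (or `0 + a` and `a`)
are not syntactically equal. -/
inductive Rel : {a b c d : ℕ} → PCExpr a b → PCExpr c d → Prop
  | refl {a b : ℕ} (f : PCExpr a b) : Rel f f
  | symm {a b c d : ℕ} {f : PCExpr a b} {g : PCExpr c d} : Rel f g → Rel g f
  | trans {a b c d e k : ℕ} {f : PCExpr a b} {g : PCExpr c d} {h : PCExpr e k} :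
      Rel f g → Rel g h → Rel f h
  | comp_congr {a b c a' b' c' : ℕ} {f : PCExpr a b} {g : PCExpr b c}
      {f' : PCExpr a' b'} {g' : PCExpr b' c'} :
      Rel f f' → Rel g g' → Rel (f.comp g) (f'.comp g')
  | tens_congr {a b c d a' b' c' d' : ℕ} {f : PCExpr a b} {g : PCExpr c d}
      {f' : PCExpr a' b'} {g' : PCExpr c' d'} :
      Rel f f' → Rel g g' → Rel (f.tens g) (f'.tens g')
  | id_comp {a b : ℕ} (f : PCExpr a b) : Rel ((idn a).comp f) f
  | comp_id {a b : ℕ} (f : PCExpr a b) : Rel (f.comp (idn b)) f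
  | comp_assoc {a b c d : ℕ} (f : PCExpr a b) (g : PCExpr b c) (h : PCExpr c d) :
      Rel ((f.comp g).comp h) (f.comp (g.comp h))
  | id_tens {a b : ℕ} (f : PCExpr a b) : Rel ((idn 0).tens f) f
  | tens_id {a b : ℕ} (f : PCExpr a b) : Rel (f.tens (idn 0)) f
  | tens_assoc {a b c d e k : ℕ} (f : PCExpr a b) (g : PCExpr c d) (h : PCExpr e k) :
      Rel ((f.tens g).tens h) (f.tens (g.tens h))
  | idn_tens_idn (m n : ℕ) : Rel ((idn m).tens (idn n)) (idn (m + n))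
  | interchange {a b c a' b' c' : ℕ} (f : PCExpr a b) (g : PCExpr b c)
      (f' : PCExpr a' b') (g' : PCExpr b' c') :
      Rel ((f.tens f').comp (g.tens g')) ((f.comp g).tens (f'.comp g'))

/-- Number of coproduct nodes. -/
def numCop : {a b : ℕ} → PCExpr a b → ℕ
  | _, _, idn _ => 0
  | _, _, cop => 1
  | _, _, prod => 0
  | _, _, comp f g => f.numCop + g.numCop
  | _, _, tens f g => f.numCop + g.numCop

/-- Number of product nodes. -/
def numProd : {a b : ℕ} → PCExpr a b → ℕ
  | _, _, idn _ => 0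
  | _, _, cop => 0
  | _, _, prod => 1
  | _, _, comp f g => f.numProd + g.numProd
  | _, _, tens f g => f.numProd + g.numProd

end PCExpr

/-- What a wire is plugged into: the input of a coproduct, the left input of a product, or the
right input of a product. -/
inductive WireKind : Type
  | copIn
  | prodLeft
  | prodRight
  deriving DecidableEq

namespace PCExpr

/-- Depth-left first search. The search started at a wire visits this wire and then
* if the wire enters a coproduct: searches from its left output, and then from its right output;
* if the wire is the left input of a product: stops (the product has to wait for its right input);
* if the wire is the right input of a product: searches from the output of the product.

The trace of a search is the list of the kinds of the visited wires, in the order of the visit.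
`trace f l` is the list of the traces of the searches started at the inputs of `f` (from left to
right), if `l` is the list of the traces of the searches started at the outputs of `f`. -/
def trace : {a b : ℕ} → PCExpr a b → List (List WireKind) → List (List WireKind)
  | _, _, idn _, l => l
  | _, _, cop, l =>
      match l with
      | [u, v] => [WireKind.copIn :: (u ++ v)]
      | _ => []
  | _, _, prod, l =>
      match l with
      | [u] => [[WireKind.prodLeft], WireKind.prodRight :: u]
      | _ => []
  | _, _, comp f g, l => f.trace (g.trace l)
  | _, _, @tens _ b _ _ f g, l => f.trace (l.take b) ++ g.trace (l.drop b)

/-- The kinds of the wires of a prograph with one input and one output, in the order of the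
depth-left first search started at its input (the global output is plugged into nothing and
contributes nothing, it would come last). -/
def word (p : PCExpr 1 1) : List WireKind := (p.trace [[]]).flatten

theorem length_trace {a b : ℕ} (f : PCExpr a b) :
    ∀ l : List (List WireKind), l.length = b → (f.trace l).length = a := by
  induction f with
  | idn n => intro l hl; simpa [trace] using hl
  | cop =>
    intro l hl
    match l, hl with
    | [u, v], _ => simp [trace]
  | prod =>
    intro l hl
    match l, hl with
    | [u], _ => simp [trace]
  | comp f g hf hg => intro l hl; exact hf _ (hg _ hl)
  | @tens a b c d f g hf hg =>
    intro l hl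
    simp only [trace, List.length_append]
    rw [hf _ (by simp [hl]), hg _ (by simp [hl])]

theorem Rel.sound {a b c d : ℕ} {f : PCExpr a b} {g : PCExpr c d} (h : Rel f g) :
    a = c ∧ b = d ∧ f.numCop = g.numCop ∧ f.numProd = g.numProd ∧
      ∀ l : List (List WireKind), l.length = b → f.trace l = g.trace l := by
  induction h with
  | refl f => simp
  | symm _ ih =>
    obtain ⟨h1, h2, h3, h4, h5⟩ := ih
    exact ⟨h1.symm, h2.symm, h3.symm, h4.symm, fun l hl => (h5 l (hl.trans h2.symm)).symm⟩
  | trans _ _ ih ih' =>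
    obtain ⟨h1, h2, h3, h4, h5⟩ := ih
    obtain ⟨k1, k2, k3, k4, k5⟩ := ih'
    exact ⟨h1.trans k1, h2.trans k2, h3.trans k3, h4.trans k4,
      fun l hl => (h5 l hl).trans (k5 l (hl.trans h2))⟩
  | @comp_congr a b c a' b' c' f g f' g' _ _ ih ih' =>
    obtain ⟨h1, h2, h3, h4, h5⟩ := ih
    obtain ⟨k1, k2, k3, k4, k5⟩ := ih'
    refine ⟨h1, k2, by simp [numCop, h3, k3], by simp [numProd, h4, k4], fun l hl => ?_⟩
    simp only [trace]
    rw [← k5 l hl, h5 _ (length_trace g l hl)]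
  | @tens_congr a b c d a' b' c' d' f g f' g' _ _ ih ih' =>
    obtain ⟨h1, h2, h3, h4, h5⟩ := ih
    obtain ⟨k1, k2, k3, k4, k5⟩ := ih'
    refine ⟨by omega, by omega, by simp [numCop, h3, k3], by simp [numProd, h4, k4],
      fun l hl => ?_⟩
    simp only [trace]
    rw [h5 _ (by simp [hl]), k5 _ (by simp [hl]), h2]
  | id_comp f => simp [numCop, numProd, trace]
  | comp_id f => simp [numCop, numProd, trace]
  | comp_assoc f g h => simp [numCop, numProd, trace, Nat.add_assoc]
  | id_tens f => simp [numCop, numProd, trace]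
  | @tens_id a b f =>
    refine ⟨by simp, by simp, by simp [numCop], by simp [numProd], fun l hl => ?_⟩
    have hl' : l.length ≤ b := by simpa using hl.le
    simp [trace, List.take_of_length_le hl', List.drop_of_length_le hl']
  | @tens_assoc a b c d e k f g h =>
    refine ⟨by omega, by omega, by simp [numCop, Nat.add_assoc],
      by simp [numProd, Nat.add_assoc], fun l hl => ?_⟩
    simp only [trace, List.append_assoc, List.take_take, List.drop_take, List.drop_drop]
    simp
  | idn_tens_idn m n => simp [numCop, numProd, trace]
  | @interchange a b c a' b' c' f g f' g' =>
    refine ⟨rfl, rfl, by simp only [numCop]; omega, by simp only [numProd]; omega,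
      fun l hl => ?_⟩
    have h1 : (g.trace (l.take c)).length = b := length_trace g _ (by simp [hl])
    simp only [trace]
    rw [List.take_left' h1, List.drop_left' h1]

theorem width_eq {a b : ℕ} (f : PCExpr a b) : a + f.numCop = b + f.numProd := by
  induction f with
  | idn n => rfl
  | cop => rfl
  | prod => rfl
  | comp f g hf hg => simp only [numCop, numProd]; omega
  | tens f g hf hg => simp only [numCop, numProd]; omega

theorem width_pos {a b : ℕ} (f : PCExpr a b) : a = 0 ↔ b = 0 := by
  induction f with
  | idn n => rfl
  | cop => simp
  | prod => simp
  | comp f g hf hg => exact hf.trans hg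
  | tens f g hf hg => omega

theorem count_trace {a b : ℕ} (f : PCExpr a b) :
    ∀ l : List (List WireKind), l.length = b →
      (f.trace l).flatten.count .copIn = l.flatten.count .copIn + f.numCop ∧
      (f.trace l).flatten.count .prodLeft = l.flatten.count .prodLeft + f.numProd ∧
      (f.trace l).flatten.count .prodRight = l.flatten.count .prodRight + f.numProd := by
  induction f with
  | idn n => intro l hl; simp [trace, numCop, numProd]
  | cop =>
    intro l hl
    match l, hl with
    | [u, v], _ => simp [trace, numCop, numProd]
  | prod =>
    intro l hl
    match l, hl with
    | [u], _ => simp [trace, numCop, numProd]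
  | @comp a b c f g hf hg =>
    intro l hl
    have h1 := hf _ (length_trace g l hl)
    have h2 := hg l hl
    simp only [trace, numCop, numProd]
    omega
  | @tens a b c d f g hf hg =>
    intro l hl
    have h1 := hf (l.take b) (by simp [hl])
    have h2 := hg (l.drop b) (by simp [hl])
    have h3 : ∀ k, l.flatten.count k =
        (l.take b).flatten.count k + (l.drop b).flatten.count k := fun k => by
      rw [← List.count_append, ← List.flatten_append, List.take_append_drop]
    simp only [trace, numCop, numProd, List.flatten_append, List.count_append, h3]
    omega

end PCExpr

/-- In every suffix of the word, `y` occurs at least as often as `x`. -/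
def SuffixDom (x y : WireKind) : List WireKind → Prop
  | [] => True
  | z :: w => (z :: w).count x ≤ (z :: w).count y ∧ SuffixDom x y w

namespace SuffixDom

theorem count_le {x y : WireKind} : ∀ {w : List WireKind}, SuffixDom x y w →
    w.count x ≤ w.count y
  | [], _ => by simp
  | _ :: _, h => h.1

theorem of_append {x y : WireKind} {v : List WireKind} : ∀ {u : List WireKind},
    SuffixDom x y (u ++ v) → SuffixDom x y v
  | [], h => h
  | _ :: _, h => of_append (And.right h)

theorem append {x y : WireKind} {v : List WireKind} (hv : SuffixDom x y v) :
    ∀ {u : List WireKind}, SuffixDom x y u → SuffixDom x y (u ++ v)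
  | [], _ => hv
  | z :: u, h => by
    have h1 := h.1
    have h2 := hv.count_le
    refine ⟨?_, append hv h.2⟩
    change ((z :: u) ++ v).count x ≤ ((z :: u) ++ v).count y
    rw [List.count_append, List.count_append]
    omega

theorem replace {x y : WireKind} {v v' : List WireKind}
    (hv : SuffixDom x y v') (hx : v'.count x + v.count y = v.count x + v'.count y) :
    ∀ {u : List WireKind}, SuffixDom x y (u ++ v) → SuffixDom x y (u ++ v')
  | [], _ => hv
  | z :: u, h => by
    have h1 : ((z :: u) ++ v).count x ≤ ((z :: u) ++ v).count y := And.left h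
    refine ⟨?_, replace hv hx (And.right h)⟩
    change ((z :: u) ++ v').count x ≤ ((z :: u) ++ v').count y
    rw [List.count_append, List.count_append] at h1 ⊢
    omega

end SuffixDom

namespace PCExpr

theorem dom_trace_right {a b : ℕ} (f : PCExpr a b) :
    ∀ (l : List (List WireKind)) (s t : List WireKind), l.length = b →
      SuffixDom .prodLeft .prodRight (s ++ (l.flatten ++ t)) →
      SuffixDom .prodLeft .prodRight (s ++ ((f.trace l).flatten ++ t)) := by
  induction f with
  | idn n => intro l s t _ h; exact h
  | cop =>
    intro l s t hl h
    match l, hl with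
    | [u, v], _ =>
      refine SuffixDom.replace (v := [u, v].flatten ++ t) ?_ ?_ h
      · have h1 := h.of_append
        have h2 := h1.count_le
        simp only [trace, List.flatten_cons, List.flatten_nil, List.append_nil,
          List.cons_append, List.append_assoc] at h1 h2 ⊢
        exact ⟨by simpa [List.count_cons] using h2, h1⟩
      · simp [trace]
  | prod =>
    intro l s t hl h
    match l, hl with
    | [u], _ =>
      refine SuffixDom.replace (v := [u].flatten ++ t) ?_ ?_ h
      · have h1 := h.of_append
        have h2 := h1.count_le
        simp only [trace, List.flatten_cons, List.flatten_nil, List.append_nil,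
          List.cons_append, List.nil_append] at h1 h2 ⊢
        refine ⟨?_, ?_, h1⟩ <;> simp at h2 ⊢ <;> omega
      · simp [trace]; omega
  | @comp a b c f g hf hg =>
    intro l s t hl h
    exact hf _ s t (length_trace g l hl) (hg l s t hl h)
  | @tens a b c d f g hf hg =>
    intro l s t hl h
    rw [← List.take_append_drop b l, List.flatten_append, List.append_assoc] at h
    have h1 := hf (l.take b) s ((l.drop b).flatten ++ t) (by simp [hl]) h
    rw [← List.append_assoc] at h1
    have h2 := hg (l.drop b) (s ++ (f.trace (l.take b)).flatten) t (by simp [hl]) h1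
    simpa [trace, List.append_assoc] using h2

/-- Invariant of the traces of the wires of a horizontal section, `c` being the number of wires
further to the right. -/
def TraceInv (c : ℕ) : List (List WireKind) → Prop
  | [] => True
  | u :: t => (SuffixDom .copIn .prodLeft u ∧
      u.count .copIn + min 1 (t.length + c) ≤ u.count .prodLeft) ∧ TraceInv c t

theorem TraceInv.append_iff {c : ℕ} {l' : List (List WireKind)} :
    ∀ {l : List (List WireKind)}, TraceInv c (l ++ l') ↔ TraceInv (l'.length + c) l ∧ TraceInv c l'
  | [] => by simp [TraceInv]
  | u :: t => by
    simp only [List.cons_append, TraceInv, TraceInv.append_iff (l := t), List.length_append,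
      Nat.add_assoc, and_assoc]

theorem TraceInv.congr {c c' : ℕ} (h : c = 0 ↔ c' = 0) :
    ∀ {l : List (List WireKind)}, TraceInv c l → TraceInv c' l
  | [], _ => trivial
  | u :: t, hl => by
    refine ⟨⟨hl.1.1, ?_⟩, TraceInv.congr h hl.2⟩
    have := hl.1.2
    omega

theorem traceInv_trace {a b : ℕ} (f : PCExpr a b) :
    ∀ (l : List (List WireKind)) (c : ℕ), l.length = b → TraceInv c l →
      TraceInv c (f.trace l) := by
  induction f with
  | idn n => intro l c _ h; exact h
  | cop =>
    intro l c hl h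
    match l, hl with
    | [u, v], _ =>
      simp only [TraceInv, trace, List.length_cons, List.length_nil] at h ⊢
      obtain ⟨⟨hu, hu'⟩, ⟨hv, hv'⟩, -⟩ := h
      refine ⟨⟨⟨?_, hv.append hu⟩, ?_⟩, trivial⟩ <;>
        simp <;> omega
  | prod =>
    intro l c hl h
    match l, hl with
    | [u], _ =>
      simp only [TraceInv, trace, List.length_cons, List.length_nil] at h ⊢
      obtain ⟨⟨hu, hu'⟩, -⟩ := h
      refine ⟨⟨?_, ?_⟩, ⟨⟨?_, hu⟩, ?_⟩, trivial⟩
      · simp [SuffixDom]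
      · simp
      · simp; omega
      · simp; omega
  | @comp a b c f g hf hg =>
    intro l k hl h
    exact hf _ k (length_trace g l hl) (hg l k hl h)
  | @tens a b c d f g hf hg =>
    intro l k hl h
    rw [← List.take_append_drop b l, TraceInv.append_iff] at h
    have hd : (l.drop b).length = d := by simp [hl]
    refine TraceInv.append_iff.2 ⟨hf _ _ (by simp [hl]) (h.1.congr ?_), hg _ _ hd h.2⟩
    rw [hd, length_trace g _ hd]
    have := g.width_pos
    omega

theorem word_spec (p : PCExpr 1 1) :
    p.word.count .copIn = p.numCop ∧ p.word.count .prodLeft = p.numCop ∧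
    p.word.count .prodRight = p.numCop ∧
    SuffixDom .copIn .prodLeft p.word ∧ SuffixDom .prodLeft .prodRight p.word := by
  have h1 := p.count_trace [[]] rfl
  have h2 := p.width_eq
  have h3 := p.dom_trace_right [[]] [] [] rfl (by simp [SuffixDom])
  have h4 := p.traceInv_trace [[]] 0 rfl (by simp [TraceInv, SuffixDom])
  have h5 := p.length_trace [[]] rfl
  refine ⟨by simpa [word] using h1.1, ?_, ?_, ?_, by simpa [word] using h3⟩
  · simp only [word, h1.2.1]; simp; omega
  · simp only [word, h1.2.2]; simp; omega
  · unfold word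
    match p.trace [[]], h5, h4 with
    | [w], _, h4 => simpa using h4.1.1

end PCExpr

/-- Equality of product-coproduct prographs (expressions with one input and one output). -/
instance prographSetoid : Setoid (PCExpr 1 1) where
  r := PCExpr.Rel
  iseqv := ⟨PCExpr.Rel.refl, PCExpr.Rel.symm, PCExpr.Rel.trans⟩

/-- Product-coproduct prographs: planar assemblies of coproducts `1 → 2` and products `2 → 1`
with a single input and a single output, that is, morphisms `1 → 1` of the free PRO. -/
def Prograph : Type := Quotient prographSetoid

namespace Prograph

/-- Number of coproduct nodes of a prograph. -/
def numCop : Prograph → ℕ := Quotient.lift PCExpr.numCop fun _ _ h => (PCExpr.Rel.sound h).2.2.1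

/-- Number of product nodes of a prograph. -/
def numProd : Prograph → ℕ :=
  Quotient.lift PCExpr.numProd fun _ _ h => (PCExpr.Rel.sound h).2.2.2.1

/-- Stacking: in `p * q` the output of `p` is grafted with the input of `q`. The unit is the empty
prograph (a single wire). -/
instance : Monoid Prograph where
  one := Quotient.mk _ (PCExpr.idn 1)
  mul := Quotient.map₂ PCExpr.comp fun _ _ h _ _ h' => PCExpr.Rel.comp_congr h h'
  mul_assoc := by
    rintro ⟨f⟩ ⟨g⟩ ⟨h⟩
    exact Quotient.sound (PCExpr.Rel.comp_assoc f g h)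
  one_mul := by
    rintro ⟨f⟩
    exact Quotient.sound (PCExpr.Rel.id_comp f)
  mul_one := by
    rintro ⟨f⟩
    exact Quotient.sound (PCExpr.Rel.comp_id f)

/-- `PC n`: the prographs with `n` coproducts and `n` products. -/
def PC (n : ℕ) : Set Prograph := {p | p.numCop = n ∧ p.numProd = n}

end Prograph

/-! ### Standard Young tableaux of rectangular shape with three rows -/

/-- Standard Young tableaux of shape `(n, n, n)` for some `n` (French convention: `row1` is the
bottom row): rows of the same length, increasing rows and columns, and entries `1, …, 3 n`. -/
@[ext]
structure RectTableau : Type where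
  row1 : List ℕ
  row2 : List ℕ
  row3 : List ℕ
  sorted1 : row1.Pairwise (· < ·)
  sorted2 : row2.Pairwise (· < ·)
  sorted3 : row3.Pairwise (· < ·)
  /-- `row1` and `row2` have the same length and increase along columns. -/
  col12 : List.Forall₂ (· < ·) row1 row2
  /-- `row2` and `row3` have the same length and increase along columns. -/
  col23 : List.Forall₂ (· < ·) row2 row3
  entries : (row1 ++ row2 ++ row3).Perm (List.range' 1 (3 * row1.length))

namespace RectTableau

/-- `ST n`: the standard Young tableaux of shape `(n, n, n)`. -/
def ST (n : ℕ) : Set RectTableau :=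
  {T | T.row1.length = n ∧ T.row2.length = n ∧ T.row3.length = n}

theorem mem_bounds (T : RectTableau) {x : ℕ} (h : x ∈ T.row1 ∨ x ∈ T.row2 ∨ x ∈ T.row3) :
    1 ≤ x ∧ x ≤ 3 * T.row1.length := by
  have h1 : x ∈ T.row1 ++ T.row2 ++ T.row3 := by simpa [or_assoc] using h
  have h2 := T.entries.mem_iff.1 h1
  simp only [List.mem_range'_1] at h2
  omega

/-- All entries shifted by `k`. -/
def shiftBy (k : ℕ) (l : List ℕ) : List ℕ := l.map (k + ·)

theorem pairwise_shift (l l' : List ℕ) (k : ℕ) (h : l.Pairwise (· < ·)) (h' : l'.Pairwise (· < ·))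
    (hl : ∀ x ∈ l, x ≤ k) (hl' : ∀ x ∈ l', 1 ≤ x) :
    (l ++ shiftBy k l').Pairwise (· < ·) := by
  rw [List.pairwise_append]
  refine ⟨h, ?_, ?_⟩
  · simpa [shiftBy, List.pairwise_map] using h'
  · intro x hx y hy
    obtain ⟨z, hz, rfl⟩ := List.mem_map.1 hy
    have := hl x hx
    have := hl' z hz
    omega

theorem forall₂_shift {l₁ l₂ m₁ m₂ : List ℕ} (k : ℕ) (h : List.Forall₂ (· < ·) l₁ l₂)
    (h' : List.Forall₂ (· < ·) m₁ m₂) :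
    List.Forall₂ (· < ·) (l₁ ++ shiftBy k m₁) (l₂ ++ shiftBy k m₂) := by
  refine List.rel_append h ?_
  simpa [shiftBy, List.forall₂_map_left_iff, List.forall₂_map_right_iff] using h'

/-- Shifted concatenation: the rows of `U`, with all entries shifted by the number of entries
of `T`, are appended to the rows of `T`. -/
def mul (T U : RectTableau) : RectTableau where
  row1 := T.row1 ++ shiftBy (3 * T.row1.length) U.row1
  row2 := T.row2 ++ shiftBy (3 * T.row1.length) U.row2
  row3 := T.row3 ++ shiftBy (3 * T.row1.length) U.row3
  sorted1 := pairwise_shift _ _ _ T.sorted1 U.sorted1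
    (fun _ h => (T.mem_bounds (Or.inl h)).2) (fun _ h => (U.mem_bounds (Or.inl h)).1)
  sorted2 := pairwise_shift _ _ _ T.sorted2 U.sorted2
    (fun _ h => (T.mem_bounds (Or.inr (Or.inl h))).2)
    (fun _ h => (U.mem_bounds (Or.inr (Or.inl h))).1)
  sorted3 := pairwise_shift _ _ _ T.sorted3 U.sorted3
    (fun _ h => (T.mem_bounds (Or.inr (Or.inr h))).2)
    (fun _ h => (U.mem_bounds (Or.inr (Or.inr h))).1)
  col12 := forall₂_shift _ T.col12 U.col12
  col23 := forall₂_shift _ T.col23 U.col23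
  entries := by
    have h1 := T.entries
    have h2 := U.entries.map (3 * T.row1.length + ·)
    rw [List.map_add_range'] at h2
    have h3 := h1.append h2
    rw [Nat.add_comm _ 1, List.range'_append_1] at h3
    simp only [List.length_append, shiftBy, List.length_map, Nat.mul_add]
    refine List.Perm.trans ?_ h3
    rw [← Multiset.coe_eq_coe]
    simp only [List.map_append, ← Multiset.coe_add]
    abel

/-- The monoid of three-row rectangular standard tableaux under shifted concatenation; the unit
is the empty tableau. -/
instance : Monoid RectTableau where
  one := ⟨[], [], [], by simp, by simp, by simp, by simp, by simp, by simp⟩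
  mul := mul
  mul_assoc T U V := by
    change mul (mul T U) V = mul T (mul U V)
    ext1 <;> simp [mul, shiftBy, Nat.mul_add, Nat.add_assoc]
  one_mul T := by
    change mul ⟨[], [], [], _, _, _, _, _, _⟩ T = T
    ext1 <;> simp [mul, shiftBy]
  mul_one T := by
    change mul T ⟨[], [], [], _, _, _, _, _, _⟩ = T
    ext1 <;> simp [mul, shiftBy]

end RectTableau

/-! ### The labeling of edges -/

/-- If the wires are numbered `i, i + 1, i + 2, …` along the word, the increasing list of the
numbers of the wires of kind `k`. -/
def labels (k : WireKind) : ℕ → List WireKind → List ℕ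
  | _, [] => []
  | i, z :: w => if z = k then i :: labels k (i + 1) w else labels k (i + 1) w

theorem le_of_mem_labels (k : WireKind) : ∀ (i : ℕ) (w : List WireKind), ∀ x ∈ labels k i w, i ≤ x
  | _, [], _, hx => by simp [labels] at hx
  | i, z :: w, x, hx => by
    have ih := le_of_mem_labels k (i + 1) w x
    by_cases hz : z = k
    · simp only [labels, if_pos hz, List.mem_cons] at hx
      rcases hx with rfl | hx
      · exact le_rfl
      · have := ih hx; omega
    · simp only [labels, if_neg hz] at hx
      have := ih hx; omega

theorem pairwise_labels (k : WireKind) : ∀ (i : ℕ) (w : List WireKind),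
    (labels k i w).Pairwise (· < ·)
  | _, [] => by simp [labels]
  | i, z :: w => by
    have ih := pairwise_labels k (i + 1) w
    by_cases hz : z = k
    · simp only [labels, if_pos hz, List.pairwise_cons]
      exact ⟨fun x hx => le_of_mem_labels k _ _ x hx, ih⟩
    · simpa only [labels, if_neg hz] using ih

theorem length_labels (k : WireKind) : ∀ (i : ℕ) (w : List WireKind),
    (labels k i w).length = w.count k
  | _, [] => by simp [labels]
  | i, z :: w => by
    have ih := length_labels k (i + 1) w
    by_cases hz : z = k <;> simp [labels, hz, ih]

theorem perm_labels : ∀ (i : ℕ) (w : List WireKind),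
    (labels .copIn i w ++ labels .prodLeft i w ++ labels .prodRight i w).Perm
      (List.range' i w.length)
  | _, [] => by simp [labels]
  | i, z :: w => by
    have ih := (perm_labels (i + 1) w).cons i
    simp only [List.length_cons, List.range'_succ]
    refine List.Perm.trans ?_ ih
    rw [← Multiset.coe_eq_coe]
    cases z <;>
      simp [labels, ← Multiset.cons_coe, ← Multiset.coe_add]

theorem length_eq_counts (w : List WireKind) :
    w.length = w.count .copIn + w.count .prodLeft + w.count .prodRight := by
  have := (perm_labels 0 w).length_eq
  simp only [List.length_append, length_labels, List.length_range'] at this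
  omega

theorem forall₂_labels {x y : WireKind} (hxy : x ≠ y) : ∀ (w : List WireKind) (i : ℕ) (l : List ℕ),
    (∀ a ∈ l, a < i) → SuffixDom x y w → l.length + w.count x = w.count y →
      List.Forall₂ (· < ·) (l ++ labels x i w) (labels y i w)
  | [], _, l, _, _, hc => by
    have : l = [] := by simpa using hc
    simp [labels, this]
  | z :: w, i, l, hl, hd, hc => by
    have hle := SuffixDom.count_le hd.2
    by_cases hx : z = x
    · subst hx
      have ih := forall₂_labels hxy w (i + 1) (l ++ [i])
        (fun a ha => by
          rcases List.mem_append.1 ha with h | h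
          · have := hl a h; omega
          · simp at h; omega)
        hd.2 (by
          simp [hxy] at hc ⊢
          omega)
      simpa [labels, hxy] using ih
    · by_cases hy : z = y
      · subst hy
        cases l with
        | nil => simp [hx] at hc; omega
        | cons a l =>
          have ih := forall₂_labels hxy w (i + 1) l
            (fun b hb => by have := hl b (by simp [hb]); omega)
            hd.2 (by simp [hx] at hc; omega)
          simpa [labels, hx] using ⟨hl a (by simp), ih⟩
      · have ih := forall₂_labels hxy w (i + 1) l
          (fun b hb => by have := hl b hb; omega)
          hd.2 (by simpa [List.count_cons, hx, hy] using hc)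
        simpa [labels, hx, hy] using ih

namespace Prograph

/-- The labeling of edges. The wires are numbered from `1` along the depth-left first search; the
first (bottom) row holds the labels of the inputs of coproducts, the second row those of the left
inputs of products, the third row those of the right inputs of products. -/
def leExpr (p : PCExpr 1 1) : RectTableau where
  row1 := labels .copIn 1 p.word
  row2 := labels .prodLeft 1 p.word
  row3 := labels .prodRight 1 p.word
  sorted1 := pairwise_labels _ _ _
  sorted2 := pairwise_labels _ _ _
  sorted3 := pairwise_labels _ _ _
  col12 := by
    obtain ⟨h1, h2, -, h4, -⟩ := p.word_spec
    exact forall₂_labels (by decide) p.word 1 [] (by simp) h4 (by simp [h1, h2])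
  col23 := by
    obtain ⟨-, h2, h3, -, h5⟩ := p.word_spec
    exact forall₂_labels (by decide) p.word 1 [] (by simp) h5 (by simp [h2, h3])
  entries := by
    obtain ⟨h1, h2, h3, -, -⟩ := p.word_spec
    have h := perm_labels 1 p.word
    rw [length_eq_counts] at h
    rw [length_labels]
    convert h using 2
    omega

/-- The map `le` from prographs to three-row rectangular standard tableaux. -/
def le : Prograph → RectTableau :=
  Quotient.lift leExpr fun p q h => by
    have hw : p.word = q.word := by
      simp only [PCExpr.word, (PCExpr.Rel.sound h).2.2.2.2 [[]] rfl]
    ext1 <;> simp [leExpr, hw]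

end Prograph

/-! ### Graded Hopf algebras on monoid algebras -/

/-- The monoid algebra `K[M]`, as a ring. This type synonym of `MonoidAlgebra K M` does not carry
the coproduct of `MonoidAlgebra` for which the elements of `M` are grouplike. -/
def MonAlg (K M : Type*) [Field K] [Monoid M] : Type _ := MonoidAlgebra K M

namespace MonAlg

noncomputable instance (K M : Type*) [Field K] [Monoid M] : Semiring (MonAlg K M) :=
  inferInstanceAs (Semiring (MonoidAlgebra K M))

/-- The usual `K`-algebra structure of `K[M]`. -/
noncomputable abbrev stdAlgebra (K M : Type*) [Field K] [Monoid M] : Algebra K (MonAlg K M) :=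
  inferInstanceAs (Algebra K (MonoidAlgebra K M))

/-- The basis element of `K[M]` given by an element of the monoid `M`. -/
noncomputable def of (K : Type*) {M : Type*} [Field K] [Monoid M] (m : M) : MonAlg K M :=
  MonoidAlgebra.of K M m

/-- The span in `K[M]` of a set of elements of `M`. -/
noncomputable def spanOf (K : Type*) {M : Type*} [Field K] [Monoid M] [Algebra K (MonAlg K M)] (s : Set M) :
    Submodule K (MonAlg K M) :=
  Submodule.span K (of K '' s)

/-- A Hopf algebra structure on the monoid algebra `K[M]` (with its usual algebra structure) whose
coproduct is the one for which the indecomposable elements of `M` (those that are not the unit and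
not a product of two non-units) are primitive. -/
structure IsPrimitivelyGenerated (K M : Type*) [Field K] [Monoid M]
    [H : HopfAlgebra K (MonAlg K M)] : Prop where
  algebra_eq : H.toAlgebra = stdAlgebra K M
  comul_of : ∀ m : M, Irreducible m →
    Coalgebra.comul (R := K) (of K m) = of K m ⊗ₜ[K] 1 + 1 ⊗ₜ[K] of K m

end MonAlg

/-- The Hopf algebra `A` is graded by the family `𝒜` of subspaces. -/
structure IsGradedHopfAlgebra (K A : Type*) [Field K] [Semiring A] [HopfAlgebra K A]
    (𝒜 : ℕ → Submodule K A) : Prop where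
  isInternal : DirectSum.IsInternal 𝒜
  one_mem : (1 : A) ∈ 𝒜 0
  mul_mem : ∀ i j : ℕ, ∀ x ∈ 𝒜 i, ∀ y ∈ 𝒜 j, x * y ∈ 𝒜 (i + j)
  comul_mem : ∀ n : ℕ, ∀ x ∈ 𝒜 n, Coalgebra.comul (R := K) x ∈
    ⨆ ij ∈ Finset.HasAntidiagonal.antidiagonal n,
      LinearMap.range (TensorProduct.map (𝒜 ij.1).subtype (𝒜 ij.2).subtype)
  counit_eq_zero : ∀ n : ℕ, n ≠ 0 → ∀ x ∈ 𝒜 n, Coalgebra.counit (R := K) x = 0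
  antipode_mem : ∀ n : ℕ, ∀ x ∈ 𝒜 n, HopfAlgebra.antipode K x ∈ 𝒜 n

/-! ### Prographs are determined by their words -/

namespace PCExpr

/-! Everything passes through the word of a prograph, the list of the kinds of its wires in search
order. The rows of `le p` are the positions of the three kinds in this word, so they carry the same
information as the word, and the increasing columns of a tableau amount to the ballot condition
`IsWord`. Two points remain: a word determines its prograph up to `Rel`, and every ballot word
occurs.

A depth-left search can be replayed from its word, with a stack of wires waiting for the right
inputs of their products. `Run` records such a replay together with the assembly it builds. The next
letter dictates the next move, so the assembly is unique (`Run.deterministic`). By structural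
induction, every expression is equivalent to the assembly replayed from its trace, however the
expression is written (`RunList.trace`); this gives `rel_of_word_eq`. Conversely, `exists_runList`
parses any ballot word from its end, and `Run.trace_eq` shows that the resulting assembly has this
word.

Stacking concatenates words (`word_comp`), so `le` is multiplicative. Ballot words are closed under
left quotients, so both monoids inherit cancellation and Levi's lemma from lists. They are also
graded with trivial part of degree zero, hence free on their irreducibles
(`IsLeviGraded.lift_bijective`). The monoid algebra is thus the free associative algebra on the
irreducibles: coproduct, counit and antipode exist and are forced by their values `m ⊗ 1 + 1 ⊗ m`,
`0` and `-m` there. The grading and the compatibility with `le` follow by induction on irreducible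
factors, since a monoid isomorphism preserves irreducibles. -/

instance {a b c d e k : ℕ} : Trans (@Rel a b c d) (@Rel c d e k) (@Rel a b e k) := ⟨Rel.trans⟩

/-- This replaces casts along arithmetic identities between numbers of wires. -/
theorem exists_rel_of_eq {a b a' b' : ℕ} (f : PCExpr a b) (ha : a = a') (hb : b = b') :
    ∃ f' : PCExpr a' b', Rel f f' := by
  subst ha hb
  exact ⟨f, Rel.refl f⟩

/-! ### Rewriting rules in the free PRO -/

theorem Rel.comp_left {a b c a' : ℕ} {f : PCExpr a b} {f' : PCExpr a' b} (h : Rel f f')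
    (g : PCExpr b c) : Rel (f.comp g) (f'.comp g) := Rel.comp_congr h (Rel.refl g)

theorem Rel.comp_right {a b c c' : ℕ} (f : PCExpr a b) {g : PCExpr b c} {g' : PCExpr b c'}
    (h : Rel g g') : Rel (f.comp g) (f.comp g') := Rel.comp_congr (Rel.refl f) h

theorem Rel.comp_tens_idn {a b c : ℕ} (f : PCExpr a b) (g : PCExpr b c) (n : ℕ) :
    Rel ((f.comp g).tens (idn n)) ((f.tens (idn n)).comp (g.tens (idn n))) :=
  (Rel.tens_congr (Rel.refl _) (Rel.symm (Rel.id_comp _))).trans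
    (Rel.symm (Rel.interchange _ _ _ _))

/-- Absorbs the trivial tail of a `RunList` with one entry, where no wire is left to the right. -/
theorem Rel.tens_idn_zero_comp {a b c k : ℕ} (e : PCExpr a b) {e' : PCExpr (b + 0) c}
    (h : Rel e' (idn k)) : Rel ((e.tens (idn 0)).comp e') e := by
  obtain rfl : b + 0 = k := h.sound.1
  exact (Rel.comp_congr (Rel.tens_id e) h).trans (Rel.comp_id e)

theorem Rel.tens_idn_add {a b : ℕ} (f : PCExpr a b) (m n : ℕ) :
    Rel (f.tens (idn (m + n))) ((f.tens (idn m)).tens (idn n)) :=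
  (Rel.tens_congr (Rel.refl f) (Rel.symm (Rel.idn_tens_idn m n))).trans
    (Rel.symm (Rel.tens_assoc _ _ _))

/-- The search started at one wire reads `u` and applies `e` to this wire and to the `i` wires to
its left, which wait for the right inputs of their products; afterwards `i'` wires wait. The
global outputs are read as left inputs of products. -/
inductive Run : List WireKind → (i i' : ℕ) → PCExpr (i + 1) i' → Prop
  | left (i : ℕ) : Run [.prodLeft] i (i + 1) (idn (i + 1))
  | right {u : List WireKind} {i i' : ℕ} {e : PCExpr (i + 1) i'} :
      Run u i i' e → Run (.prodRight :: u) (i + 1) i' (((idn i).tens prod).comp e)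
  | cop {u v : List WireKind} {i i₁ i₂ : ℕ} {e₁ : PCExpr (i + 1) i₁} {e₂ : PCExpr (i₁ + 1) i₂} :
      Run u i i₁ e₁ → Run v i₁ i₂ e₂ →
      Run (.copIn :: (u ++ v)) i i₂ (((idn i).tens cop).comp ((e₁.tens (idn 1)).comp e₂))

/-- The same as `Run` for the searches started at several consecutive wires. -/
def RunList : List (List WireKind) → ℕ → ℕ → {a b : ℕ} → PCExpr a b → Prop
  | [], i, i', _, _, e => i = i' ∧ Rel e (idn i)
  | u :: us, i, i', _, _, e => ∃ (i₁ : ℕ) (e₁ : PCExpr (i + 1) i₁)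
      (e₂ : PCExpr (i₁ + us.length) i'), Run u i i₁ e₁ ∧ RunList us i₁ i' e₂ ∧
        Rel e ((e₁.tens (idn us.length)).comp e₂)

theorem RunList.congr {l : List (List WireKind)} {i i' a b a' b' : ℕ} {e : PCExpr a b}
    {e' : PCExpr a' b'} (h : RunList l i i' e) (he : Rel e e') : RunList l i i' e' := by
  cases l with
  | nil => exact ⟨h.1, he.symm.trans h.2⟩
  | cons u us =>
    obtain ⟨i₁, e₁, e₂, h1, h2, h3⟩ := h
    exact ⟨i₁, e₁, e₂, h1, h2, he.symm.trans h3⟩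

/-- Consecutive wires are searched from left to right, so the searches in `l₂` start with the wires
that those in `l₁` left waiting. -/
theorem runList_append_iff {l₁ l₂ : List (List WireKind)} :
    ∀ {i i' a b : ℕ} {e : PCExpr a b}, RunList (l₁ ++ l₂) i i' e ↔
      ∃ (i₁ : ℕ) (e₁ : PCExpr (i + l₁.length) i₁) (e₂ : PCExpr (i₁ + l₂.length) i'),
        RunList l₁ i i₁ e₁ ∧ RunList l₂ i₁ i' e₂ ∧
          Rel e ((e₁.tens (idn l₂.length)).comp e₂) := by
  induction l₁ with
  | nil =>
    intro i i' a b e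
    constructor
    · intro h
      -- The arities of `e` are unconstrained in the type of `RunList`; soundness of `Rel` recovers
      -- them.
      have hi : a = i + l₂.length ∧ b = i' := by
        cases l₂ with
        | nil => exact ⟨h.2.sound.1, h.2.sound.2.1.trans h.1⟩
        | cons u us =>
          obtain ⟨i₁, e₁, e₂, h1, h2, h3⟩ := h
          exact ⟨by rw [h3.sound.1, List.length_cons]; omega, h3.sound.2.1⟩
      obtain ⟨rfl, rfl⟩ := hi
      refine ⟨i, idn i, e, ⟨rfl, Rel.refl _⟩, h, Rel.symm ?_⟩
      exact ((Rel.idn_tens_idn _ _).comp_left e).trans (Rel.id_comp e)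
    · rintro ⟨i₁, e₁, e₂, ⟨rfl, h1⟩, h2, h3⟩
      refine h2.congr (Rel.symm (h3.trans ?_))
      have h4 : Rel (e₁.tens (idn l₂.length)) (idn (i + l₂.length)) :=
        (Rel.tens_congr h1 (Rel.refl _)).trans (Rel.idn_tens_idn _ _)
      exact (Rel.comp_congr h4 (Rel.refl e₂)).trans (Rel.id_comp e₂)
  | cons u us ih =>
    intro i i' a b e
    -- Both bracketings of the three stages `u`, `us`, `l₂` denote the same assembly.
    have key : ∀ {i₀ i₁ : ℕ} (e₀ : PCExpr (i + 1) i₀) (e₁ : PCExpr (i₀ + us.length) i₁)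
        (e₂ : PCExpr (i₁ + l₂.length) i') (e' : PCExpr (i₀ + (us ++ l₂).length) i'),
        Rel e' ((e₁.tens (idn l₂.length)).comp e₂) →
        Rel ((e₀.tens (idn (us ++ l₂).length)).comp e')
          ((((e₀.tens (idn us.length)).comp e₁).tens (idn l₂.length)).comp e₂) := by
      intro i₀ i₁ e₀ e₁ e₂ e' h
      have h0 : Rel (e₀.tens (idn (us ++ l₂).length))
          ((e₀.tens (idn us.length)).tens (idn l₂.length)) := by
        rw [List.length_append]; exact Rel.tens_idn_add _ _ _
      calc
        Rel _ (((e₀.tens (idn us.length)).tens (idn l₂.length)).comp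
            ((e₁.tens (idn l₂.length)).comp e₂)) := Rel.comp_congr h0 h
        Rel _ ((((e₀.tens (idn us.length)).tens (idn l₂.length)).comp
            (e₁.tens (idn l₂.length))).comp e₂) := Rel.symm (Rel.comp_assoc _ _ _)
        Rel _ _ := (Rel.symm (Rel.comp_tens_idn _ _ _)).comp_left e₂
    constructor
    · rintro ⟨i₀, e₀, e', h1, h2, h3⟩
      obtain ⟨i₁, e₁, e₂, h4, h5, h6⟩ := ih.1 h2
      obtain ⟨f, hf⟩ := exists_rel_of_eq ((e₀.tens (idn us.length)).comp e₁)
        (show i + 1 + us.length = i + (u :: us).length by rw [List.length_cons]; omega) rfl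
      refine ⟨i₁, f, e₂, ⟨i₀, e₀, e₁, h1, h4, hf.symm⟩, h5, (h3.trans (key e₀ e₁ e₂ e' h6)).trans ?_⟩
      exact Rel.comp_congr (Rel.tens_congr hf (Rel.refl _)) (Rel.refl _)
    · rintro ⟨i₁, f, e₂, ⟨i₀, e₀, e₁, h1, h4, hf⟩, h5, h6⟩
      obtain ⟨e', he'⟩ := exists_rel_of_eq ((e₁.tens (idn l₂.length)).comp e₂)
        (show i₀ + us.length + l₂.length = i₀ + (us ++ l₂).length by
          rw [List.length_append]; omega) rfl
      refine ⟨i₀, e₀, e', h1, ih.2 ⟨i₁, e₁, e₂, h4, h5, he'.symm⟩, h6.trans ?_⟩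
      refine Rel.trans ?_ (key e₀ e₁ e₂ e' he'.symm).symm
      exact Rel.comp_congr (Rel.tens_congr hf (Rel.refl _)) (Rel.refl _)

/-- Putting `f` below wires whose searches can be replayed yields wires whose searches replay `f`
first. This is the normal form theorem: the replay rebuilds the assembly from traces alone, whatever
expression was chosen for it. -/
theorem RunList.trace {a b : ℕ} (f : PCExpr a b) :
    ∀ {l : List (List WireKind)} {i i' : ℕ} {e : PCExpr (i + b) i'}, l.length = b →
      RunList l i i' e → RunList (f.trace l) i i' (((idn i).tens f).comp e) := by
  induction f with
  | idn n =>
    intro l i i' e _ h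
    refine h.congr (Rel.symm ?_)
    exact ((Rel.idn_tens_idn _ _).comp_left e).trans (Rel.id_comp e)
  | cop =>
    intro l i i' e hl h
    match l, hl with
    | [u, v], _ =>
      obtain ⟨i₁, e₁, e₂, h1, ⟨i₂, e₃, e₄, h2, ⟨rfl, h3⟩, h4⟩, h5⟩ := h
      refine ⟨i₂, _, idn i₂, Run.cop h1 h2, ⟨rfl, Rel.refl _⟩, ?_⟩
      refine Rel.trans (Rel.comp_right _ ?_) (Rel.tens_idn_zero_comp _ (Rel.refl _)).symm
      exact h5.trans (Rel.comp_right _ (h4.trans (Rel.tens_idn_zero_comp _ h3)))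
  | prod =>
    intro l i i' e hl h
    match l, hl with
    | [u], _ =>
      obtain ⟨i₁, e₁, e₂, h1, ⟨rfl, h2⟩, h3⟩ := h
      refine ⟨i + 1, _, ((idn i).tens prod).comp e, Run.left i,
        ⟨i₁, _, idn i₁, Run.right h1, ⟨rfl, Rel.refl _⟩, ?_⟩, ?_⟩
      · refine Rel.trans (Rel.comp_right _ ?_) (Rel.tens_idn_zero_comp _ (Rel.refl _)).symm
        exact h3.trans (Rel.tens_idn_zero_comp _ h2)
      · exact (Rel.trans ((Rel.idn_tens_idn (i + 1) 1).comp_left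
          (((idn i).tens prod).comp e)) (Rel.id_comp _)).symm
  | @comp a b c f g hf hg =>
    intro l i i' e hl h
    refine (hf (length_trace g l hl) (hg hl h)).congr ?_
    refine (Rel.symm (Rel.comp_assoc _ _ _)).trans (Rel.comp_left ?_ _)
    exact (Rel.interchange _ _ _ _).trans (Rel.tens_congr (Rel.id_comp _) (Rel.refl _))
  | @tens a b c d f g hf hg =>
    intro l i i' e hl h
    obtain ⟨l₁, l₂, rfl, rfl, rfl⟩ :
        ∃ l₁ l₂ : List (List WireKind), l = l₁ ++ l₂ ∧ l₁.length = b ∧ l₂.length = d :=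
      ⟨l.take b, l.drop b, by simp, by simp [hl], by simp [hl]⟩
    obtain ⟨i₁, e₁, e₂, h1, h2, h3⟩ := runList_append_iff.1 h
    have h4 := hf rfl h1
    have h5 := hg rfl h2
    have k1 := length_trace f _ (rfl : l₁.length = _)
    have k2 := length_trace g _ (rfl : l₂.length = _)
    simp only [PCExpr.trace, List.take_left', List.drop_left']
    refine runList_append_iff.2 ?_
    -- Once the traces are variables, their lengths can be substituted for the numbers of inputs,
    -- and the arities match without casts.
    generalize f.trace l₁ = m₁ at *
    generalize g.trace l₂ = m₂ at *
    subst k1 k2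
    refine ⟨i₁, _, _, h4, h5, ?_⟩
    calc
      Rel _ ((((idn i).tens f).tens g).comp ((e₁.tens (idn l₂.length)).comp e₂)) :=
        Rel.comp_congr (Rel.symm (Rel.tens_assoc _ _ _)) h3
      Rel _ (((((idn i).tens f).tens g).comp (e₁.tens (idn l₂.length))).comp e₂) :=
        Rel.symm (Rel.comp_assoc _ _ _)
      Rel _ ((((((idn i).tens f).comp e₁).tens (idn m₂.length)).comp
          ((idn i₁).tens g)).comp e₂) := by
        refine Rel.comp_left ?_ _
        -- Interchange slides `g` past `e₁`: the searches through `f` finish before those through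
        -- `g` begin.
        refine (Rel.interchange _ _ _ _).trans (Rel.trans ?_ (Rel.interchange _ _ _ _).symm)
        exact Rel.tens_congr (Rel.comp_id _).symm ((Rel.comp_id _).trans (Rel.id_comp _).symm)
      Rel _ _ := Rel.comp_assoc _ _ _

/-- The first letter decides the constructor, so the words of runs from `i` waiting wires form a
prefix code. The arbitrary tails `x`, `x'` are what locates the end of the first search in the
coproduct case. -/
theorem Run.deterministic {u : List WireKind} {i j : ℕ} {e : PCExpr (i + 1) j} (h : Run u i j e) :
    ∀ {u' : List WireKind} {j' : ℕ} {e' : PCExpr (i + 1) j'} {x x' : List WireKind},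
      Run u' i j' e' → u ++ x = u' ++ x' → u = u' ∧ j = j' ∧ Rel e e' := by
  induction h with
  | left i =>
    intro u' j' e' x x' h' hx
    cases h' with
    | left => exact ⟨rfl, rfl, Rel.refl _⟩
    | right h' => simp at hx
    | cop h1 h2 => simp at hx
  | right h ih =>
    intro u' j' e' x x' h' hx
    cases h' with
    | left => simp at hx
    | right h' =>
      obtain ⟨rfl, rfl, h3⟩ := ih h' (by simpa using hx)
      exact ⟨rfl, rfl, Rel.comp_right _ h3⟩
    | cop h1 h2 => simp at hx
  | cop h1 h2 ih1 ih2 =>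
    intro u' j' e' x x' h' hx
    cases h' with
    | left => simp at hx
    | right h' => simp at hx
    | cop k1 k2 =>
      simp only [List.cons_append, List.append_assoc, List.cons.injEq, true_and] at hx
      obtain ⟨rfl, rfl, h3⟩ := ih1 k1 hx
      obtain ⟨rfl, rfl, h4⟩ := ih2 k2 (List.append_cancel_left hx)
      exact ⟨rfl, rfl, Rel.comp_right _
        (Rel.comp_congr (Rel.tens_congr h3 (Rel.refl _)) h4)⟩

/-- Ending every output with `prodLeft` makes the search repeat the run; each wire that was already
waiting contributes a single letter. This identifies the word of an assembly built by parsing. -/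
theorem Run.trace_eq {u : List WireKind} {i i' : ℕ} {e : PCExpr (i + 1) i'} (h : Run u i i' e) :
    e.trace (List.replicate i' [.prodLeft]) = List.replicate i [.prodLeft] ++ [u] := by
  induction h with
  | left i => simp [trace, List.replicate_succ']
  | @right u i i' e h ih =>
    simp only [trace, ih]
    rw [List.take_left' (by simp), List.drop_left' (by simp)]
    simp [List.replicate_succ']
  | @cop u v i i₁ i₂ e₁ e₂ h1 h2 ih1 ih2 =>
    simp only [trace, ih2]
    rw [List.take_left' (l₂ := [v]) (by simp), List.drop_left' (l₂ := [v]) (by simp), ih1,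
      List.append_assoc, List.take_left' (by simp), List.drop_left' (by simp)]
    simp

/-- The search from the last input ends with the search from the last output, so anything that
continues the latter continues the former. -/
theorem trace_append_last {a b : ℕ} (f : PCExpr a b) :
    ∀ (l : List (List WireKind)) (u : List WireKind), l.length + 1 = b →
      ∃ l' u', f.trace (l ++ [u]) = l' ++ [u'] ∧
        ∀ t, f.trace (l ++ [u ++ t]) = l' ++ [u' ++ t] := by
  induction f with
  | idn n => intro l u _; exact ⟨l, u, rfl, fun _ => rfl⟩
  | cop =>
    intro l u hl
    match l, hl with
    | [v], _ => exact ⟨[], .copIn :: (v ++ u), by simp [trace], by simp [trace]⟩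
  | prod =>
    intro l u hl
    match l, hl with
    | [], _ => exact ⟨[[.prodLeft]], .prodRight :: u, by simp [trace], by simp [trace]⟩
  | @comp a b c f g hf hg =>
    intro l u hl
    obtain ⟨l', u', h1, h2⟩ := hg l u hl
    have h3 := length_trace g (l ++ [u]) (by simp [hl])
    obtain ⟨l'', u'', h4, h5⟩ := hf l' u' (by simpa [h1] using h3)
    exact ⟨l'', u'', by simp only [trace, h1, h4], fun t => by simp only [trace, h2, h5]⟩
  | @tens a b c d f g hf hg =>
    intro l u hl
    -- If `g` has no outputs it has no inputs either, and the last wire belongs to `f`.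
    rcases Nat.eq_zero_or_pos d with rfl | hd
    · obtain ⟨l', u', h1, h2⟩ := hf l u (by simpa using hl)
      have hg0 : g.trace [] = [] := by
        rw [← List.length_eq_zero_iff, length_trace g [] rfl]
        exact g.width_pos.2 rfl
      refine ⟨l', u', ?_, fun t => ?_⟩
      · rw [trace, List.take_of_length_le (by simp; omega), List.drop_of_length_le (by simp; omega),
          hg0, h1, List.append_nil]
      · rw [trace, List.take_of_length_le (by simp; omega), List.drop_of_length_le (by simp; omega),
          hg0, h2, List.append_nil]
    · obtain ⟨l', u', h1, h2⟩ := hg (l.drop b) u (by simp; omega)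
      refine ⟨f.trace (l.take b) ++ l', u', ?_, fun t => ?_⟩
      · rw [trace, List.take_append_of_le_length (by omega),
          List.drop_append_of_le_length (by omega), h1, List.append_assoc]
      · rw [trace, List.take_append_of_le_length (by omega),
          List.drop_append_of_le_length (by omega), h2, List.append_assoc]

theorem trace_singleton (p : PCExpr 1 1) (t : List WireKind) : p.trace [t] = [p.word ++ t] := by
  obtain ⟨l', u', h1, h2⟩ := p.trace_append_last [] [] rfl
  have h3 := length_trace p [[]] rfl
  simp only [List.nil_append] at h1 h2
  rw [h1] at h3
  obtain rfl : l' = [] := by simpa using h3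
  simp [word, h1, h2]

theorem word_comp (p q : PCExpr 1 1) : (p.comp q).word = p.word ++ q.word := by
  have h : q.trace [[]] = [q.word] := by simpa using q.trace_singleton []
  rw [word, trace, h, trace_singleton, List.flatten_singleton]

theorem run_word (p : PCExpr 1 1) : ∃ e : PCExpr 1 1, Run (p.word ++ [.prodLeft]) 0 1 e ∧
    Rel p e := by
  -- The global output, read as a left input, ends the search with exactly one waiting wire.
  have h0 : RunList [[.prodLeft]] 0 1 (idn (0 + 1)) :=
    ⟨1, _, idn 1, Run.left 0, ⟨rfl, Rel.refl _⟩, (Rel.tens_idn_zero_comp _ (Rel.refl _)).symm⟩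
  have h1 := h0.trace p rfl
  rw [trace_singleton] at h1
  obtain ⟨i₁, e₁, e₂, h2, ⟨rfl, h3⟩, h4⟩ := h1
  refine ⟨e₁, h2, ?_⟩
  calc
    Rel p ((idn 0).tens p) := (Rel.id_tens p).symm
    Rel _ (((idn 0).tens p).comp (idn (0 + 1))) := (Rel.comp_id _).symm
    Rel _ _ := h4
    Rel _ e₁ := Rel.tens_idn_zero_comp _ h3

/-- Both expressions are equivalent to replays of the same word, and replays are unique. -/
theorem rel_of_word_eq {p q : PCExpr 1 1} (h : p.word = q.word) : Rel p q := by
  obtain ⟨e, he, hp⟩ := p.run_word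
  obtain ⟨e', he', hq⟩ := q.run_word
  rw [h] at he
  exact (hp.trans (he.deterministic (x := []) (x' := []) he' rfl).2.2).trans hq.symm

/-- Parsing from the end of the word keeps a stack `l` of `j` complete searches, started with `i`
waiting wires. In front of them, `copIn` merges the top two searches, `prodLeft` pushes a one-letter
search and `prodRight` lengthens the top one. Suffix dominance keeps the stack high enough and `i`
nonnegative. -/
theorem exists_runList : ∀ (v : List WireKind) (i j : ℕ),
    SuffixDom .copIn .prodLeft v → SuffixDom .prodLeft .prodRight v →
    i + v.count .prodLeft = v.count .prodRight → j + v.count .copIn = v.count .prodLeft + 1 →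
    ∃ (l : List (List WireKind)) (e : PCExpr (i + j) 1), l.flatten = v ++ [.prodLeft] ∧
      l.length = j ∧ RunList l i 1 e
  | [], i, j, _, _, hi, hj => by
    obtain rfl : i = 0 := by simpa using hi
    obtain rfl : j = 1 := by simpa using hj
    exact ⟨[[.prodLeft]], idn 1, rfl, rfl, 1, _, idn 1, Run.left 0, ⟨rfl, Rel.refl _⟩,
      (Rel.tens_idn_zero_comp _ (Rel.refl _)).symm⟩
  | z :: v, i, j, hd, hd', hi, hj => by
    have c1 := hd.count_le
    have c2 := hd.2.count_le
    have c3 := hd'.2.count_le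
    cases z with
    | copIn =>
      simp at hi hj c1 c2
      obtain ⟨l, e, h1, h2, h3⟩ := exists_runList v i (j + 1) hd.2 hd'.2 hi (by omega)
      match l, h2 with
      | u :: u' :: us, h2 =>
        obtain ⟨i₁, e₁, e₂, h4, ⟨i₂, e₃, e₄, h5, h6, -⟩, -⟩ := h3
        obtain rfl : us.length + 1 = j := by simpa using h2
        obtain ⟨f, hf⟩ := exists_rel_of_eq
          (((((idn i).tens cop).comp ((e₁.tens (idn 1)).comp e₃)).tens (idn us.length)).comp e₄)
          (show i + 1 + us.length = i + (us.length + 1) by omega) rfl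
        exact ⟨(.copIn :: (u ++ u')) :: us, f, by simpa using h1, by simp, i₂, _, e₄,
          Run.cop h4 h5, h6, hf.symm⟩
      | [_], h2 => simp at h2; omega
    | prodLeft =>
      simp at hi hj c1 c2
      obtain ⟨k, rfl⟩ : ∃ k, j = k + 1 := ⟨j - 1, by omega⟩
      obtain ⟨l, e, h1, h2, h3⟩ := exists_runList v (i + 1) k hd.2 hd'.2 (by omega) (by omega)
      subst h2
      obtain ⟨f, hf⟩ := exists_rel_of_eq (((idn (i + 1)).tens (idn l.length)).comp e)
        (show i + 1 + l.length = i + (l.length + 1) by omega) rfl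
      exact ⟨[.prodLeft] :: l, f, by simp [h1], by simp, i + 1, _, e, Run.left i, h3, hf.symm⟩
    | prodRight =>
      simp at hi hj c1 c2
      obtain ⟨k, rfl⟩ : ∃ k, i = k + 1 := ⟨i - 1, by omega⟩
      obtain ⟨l, e, h1, h2, h3⟩ := exists_runList v k j hd.2 hd'.2 (by omega) hj
      match l, h2 with
      | [], h2 => simp at h2; omega
      | u :: us, h2 =>
        subst h2
        obtain ⟨i₁, e₁, e₂, h4, h5, -⟩ := h3
        obtain ⟨f, hf⟩ := exists_rel_of_eq
          (((((idn k).tens prod).comp e₁).tens (idn us.length)).comp e₂)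
          (show k + 1 + 1 + us.length = k + 1 + (us.length + 1) by omega) rfl
        exact ⟨(.prodRight :: u) :: us, f, by simpa using h1, rfl, i₁, _, e₂,
          Run.right h4, h5, hf.symm⟩

/-- The words of prographs: in every prefix there are at least as many inputs of coproducts as
left inputs of products and at least as many of these as right inputs, with equality for the
whole word. -/
structure IsWord (w : List WireKind) : Prop where
  count₁ : w.count .copIn = w.count .prodLeft
  count₂ : w.count .prodLeft = w.count .prodRight
  dom₁ : SuffixDom .copIn .prodLeft w
  dom₂ : SuffixDom .prodLeft .prodRight w

theorem isWord_word (p : PCExpr 1 1) : IsWord p.word := by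
  obtain ⟨h1, h2, h3, h4, h5⟩ := p.word_spec
  exact ⟨h1.trans h2.symm, h2.trans h3.symm, h4, h5⟩

theorem IsWord.exists_word_eq {w : List WireKind} (h : IsWord w) : ∃ p : PCExpr 1 1, p.word = w := by
  obtain ⟨l, e, h1, h2, h3⟩ := exists_runList w 0 1 h.dom₁ h.dom₂ (by simp [h.count₂])
    (by rw [h.count₁, add_comm])
  match l, h2 with
  | [u], _ =>
    obtain ⟨i₁, e₁, e₂, h4, ⟨rfl, -⟩, -⟩ := h3
    obtain rfl : u = w ++ [.prodLeft] := by simpa using h1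
    have h5 := h4.trace_eq
    refine ⟨e₁, ?_⟩
    change e₁.trace [[.prodLeft]] = [w ++ [.prodLeft]] at h5
    rw [trace_singleton e₁] at h5
    simpa using h5

/-- Counts subtract and suffix dominance passes to suffixes. This closure under left quotients lets
Levi's lemma descend from lists to prographs. -/
theorem IsWord.of_append {u v : List WireKind} (hu : IsWord u) (h : IsWord (u ++ v)) : IsWord v where
  count₁ := by
    have h1 := h.count₁
    rw [List.count_append, List.count_append, hu.count₁] at h1
    omega
  count₂ := by
    have h1 := h.count₂
    rw [List.count_append, List.count_append, hu.count₂] at h1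
    omega
  dom₁ := h.dom₁.of_append
  dom₂ := h.dom₂.of_append

end PCExpr

/-! ### The labeling of edges is an isomorphism of monoids -/

/-! ### Labels as positions of letters in a word -/

theorem labels_append (k : WireKind) : ∀ (i : ℕ) (w w' : List WireKind),
    labels k i (w ++ w') = labels k i w ++ labels k (i + w.length) w'
  | _, [], _ => by simp [labels]
  | i, z :: w, w' => by
    have ih := labels_append k (i + 1) w w'
    rw [Nat.add_right_comm, Nat.add_assoc] at ih
    by_cases hz : z = k <;> simp [labels, hz, ih]

theorem labels_add (k : WireKind) : ∀ (i j : ℕ) (w : List WireKind),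
    labels k (j + i) w = (labels k i w).map (j + ·)
  | _, _, [] => by simp [labels]
  | i, j, z :: w => by
    have ih := labels_add k (i + 1) j w
    rw [← Nat.add_assoc] at ih
    by_cases hz : z = k <;> simp [labels, hz, ih]

/-- The label `i` lies only in the list for the kind of the first letter, so the lists determine the
word letter by letter. -/
theorem eq_of_labels_eq : ∀ (i : ℕ) (w w' : List WireKind),
    (∀ k, labels k i w = labels k i w') → w = w'
  | _, [], [], _ => rfl
  | i, [], z :: w', h => by simpa [labels] using h z
  | i, z :: w, [], h => by simpa [labels] using h z
  | i, z :: w, z' :: w', h => by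
    have hz : z = z' := by
      by_contra hne
      have h1 := h z
      simp only [labels, if_pos, if_neg (Ne.symm hne)] at h1
      have h2 := le_of_mem_labels z (i + 1) w' i (by rw [← h1]; simp)
      omega
    subst hz
    rw [eq_of_labels_eq (i + 1) w w' fun k => ?_]
    have h1 := h k
    by_cases hk : z = k
    · simpa [labels, hk] using h1
    · simpa [labels, hk] using h1

theorem labels_map_range' (k : WireKind) (f : ℕ → WireKind) : ∀ (n i : ℕ),
    labels k i ((List.range' i n).map f) = (List.range' i n).filter (f · = k)
  | 0, i => by simp [labels]
  | n + 1, i => by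
    have ih := labels_map_range' k f n (i + 1)
    by_cases hk : f i = k <;> simp [labels, List.range'_succ, hk, ih]

/-- The labels that are at least `j` belong to the letters of the suffix starting at position `j`,
so counting them counts letters in suffixes. -/
theorem suffixDom_of_countP_labels (x y : WireKind) : ∀ (i : ℕ) (w : List WireKind),
    (∀ j, i ≤ j → (labels x i w).countP (j ≤ ·) ≤ (labels y i w).countP (j ≤ ·)) →
      SuffixDom x y w
  | _, [], _ => trivial
  | i, z :: w, h => by
    have hall : ∀ k, (labels k i (z :: w)).countP (i ≤ ·) = (z :: w).count k := fun k => by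
      rw [← length_labels k i, List.countP_eq_length]
      intro a ha
      simpa using le_of_mem_labels k i _ a ha
    have htail : ∀ k j, i + 1 ≤ j →
        (labels k i (z :: w)).countP (j ≤ ·) = (labels k (i + 1) w).countP (j ≤ ·) := by
      intro k j hj
      by_cases hz : z = k
      · simp only [labels, if_pos hz]
        exact List.countP_cons_of_neg (by simpa using hj)
      · simp only [labels, if_neg hz]
    refine ⟨?_, suffixDom_of_countP_labels x y (i + 1) w fun j hj => ?_⟩
    · simpa only [hall] using h i le_rfl
    · simpa only [htail _ j hj] using h j (by omega)

theorem List.Forall₂.countP_le_countP {l l' : List ℕ} (h : List.Forall₂ (· < ·) l l') (j : ℕ) :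
    l.countP (j ≤ ·) ≤ l'.countP (j ≤ ·) := by
  induction h with
  | nil => simp
  | @cons a b l l' hab _ ih =>
    simp only [List.countP_cons, decide_eq_true_eq]
    split_ifs <;> omega

/-! ### From tableaux to ballot words -/

namespace RectTableau

/-- The letter at position `x` names the row containing `x`; entries fill `1, …, 3n` without
repetition, so this is well defined. -/
theorem exists_labels_eq (T : RectTableau) : ∃ w : List WireKind,
    labels .copIn 1 w = T.row1 ∧ labels .prodLeft 1 w = T.row2 ∧ labels .prodRight 1 w = T.row3 := by
  classical
  let f : ℕ → WireKind := fun x =>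
    if x ∈ T.row1 then .copIn else if x ∈ T.row2 then .prodLeft else .prodRight
  have hnd : (T.row1 ++ T.row2 ++ T.row3).Nodup := T.entries.nodup_iff.2 List.nodup_range'
  have hmem : ∀ x, x ∈ List.range' 1 (3 * T.row1.length) ↔ x ∈ T.row1 ∨ x ∈ T.row2 ∨ x ∈ T.row3 :=
    fun x => by rw [← T.entries.mem_iff]; simp
  rw [List.nodup_append, List.nodup_append] at hnd
  have h12 : ∀ x, x ∈ T.row1 → x ∉ T.row2 := fun x h h' => hnd.1.2.2 x h x h' rfl
  have h123 : ∀ x, x ∈ T.row3 → x ∉ T.row1 ∧ x ∉ T.row2 := fun x h =>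
    ⟨fun h' => hnd.2.2 x (by simp [h']) x h rfl, fun h' => hnd.2.2 x (by simp [h']) x h rfl⟩
  have key : ∀ (k : WireKind) (l : List ℕ), l.Pairwise (· < ·) →
      (∀ x, x ∈ List.range' 1 (3 * T.row1.length) ∧ f x = k ↔ x ∈ l) →
      labels k 1 ((List.range' 1 (3 * T.row1.length)).map f) = l := by
    intro k l hl h
    have hs := pairwise_labels k 1 ((List.range' 1 (3 * T.row1.length)).map f)
    -- Strictly increasing lists with the same members coincide.
    refine List.Perm.eq_of_pairwise (fun a b _ _ h1 h2 => (lt_asymm h1 h2).elim) hs hl ?_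
    rw [List.perm_ext_iff_of_nodup (hs.imp ne_of_lt) (hl.imp ne_of_lt)]
    intro x
    rw [labels_map_range', List.mem_filter, decide_eq_true_eq, h]
  refine ⟨(List.range' 1 (3 * T.row1.length)).map f, key _ _ T.sorted1 ?_, key _ _ T.sorted2 ?_,
    key _ _ T.sorted3 ?_⟩
  all_goals
    intro x
    have h1 := h12 x
    have h2 := h123 x
    rw [hmem]
    simp only [f]
    split_ifs <;> simp <;> tauto

theorem isWord_of_labels_eq (T : RectTableau) {w : List WireKind} (h1 : labels .copIn 1 w = T.row1)
    (h2 : labels .prodLeft 1 w = T.row2) (h3 : labels .prodRight 1 w = T.row3) :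
    PCExpr.IsWord w where
  count₁ := by
    rw [← length_labels _ 1, ← length_labels _ 1, h1, h2, T.col12.length_eq]
  count₂ := by
    rw [← length_labels _ 1, ← length_labels _ 1, h2, h3, T.col23.length_eq]
  dom₁ := suffixDom_of_countP_labels _ _ 1 w fun j _ => by
    rw [h1, h2]; exact T.col12.countP_le_countP j
  dom₂ := suffixDom_of_countP_labels _ _ 1 w fun j _ => by
    rw [h2, h3]; exact T.col23.countP_le_countP j

end RectTableau

/-! ### Words of prographs and the bijection -/

namespace Prograph

/-- The kinds of the wires of a prograph in the order of the depth-left first search. -/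
def word : Prograph → List WireKind :=
  Quotient.lift PCExpr.word fun p q h => by
    simp only [PCExpr.word, (PCExpr.Rel.sound h).2.2.2.2 [[]] rfl]

theorem word_injective : Function.Injective word := by
  rintro ⟨p⟩ ⟨q⟩ h
  exact Quotient.sound (PCExpr.rel_of_word_eq h)

theorem word_mul (p q : Prograph) : (p * q).word = p.word ++ q.word := by
  induction p using Quotient.inductionOn
  induction q using Quotient.inductionOn
  exact PCExpr.word_comp _ _

theorem word_one : (1 : Prograph).word = [] := rfl

theorem isWord_word (p : Prograph) : PCExpr.IsWord p.word := by
  induction p using Quotient.inductionOn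
  exact PCExpr.isWord_word _

theorem exists_word_eq {w : List WireKind} (h : PCExpr.IsWord w) : ∃ p : Prograph, p.word = w := by
  obtain ⟨p, hp⟩ := h.exists_word_eq
  exact ⟨Quotient.mk _ p, hp⟩

theorem numCop_eq_count (p : Prograph) : p.numCop = p.word.count .copIn := by
  induction p using Quotient.inductionOn with
  | h p => exact p.word_spec.1.symm

theorem numProd_eq_numCop (p : Prograph) : p.numProd = p.numCop := by
  induction p using Quotient.inductionOn with
  | h p =>
    have h := p.width_eq
    change p.numProd = p.numCop
    omega

theorem row1_le (p : Prograph) : (le p).row1 = labels .copIn 1 p.word := by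
  induction p using Quotient.inductionOn
  rfl

theorem row2_le (p : Prograph) : (le p).row2 = labels .prodLeft 1 p.word := by
  induction p using Quotient.inductionOn
  rfl

theorem row3_le (p : Prograph) : (le p).row3 = labels .prodRight 1 p.word := by
  induction p using Quotient.inductionOn
  rfl

theorem length_word (p : Prograph) : p.word.length = 3 * p.word.count .copIn := by
  have h := p.isWord_word
  rw [length_eq_counts, ← h.count₂, ← h.count₁]
  omega

/-- Concatenation shifts the labels of the second word by the length of the first, which is `3n`
because the three kinds occur equally often. This is the shift in the product of tableaux. -/
theorem le_mul (p q : Prograph) : le (p * q) = le p * le q := by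
  have hl : (le p).row1.length = p.word.count .copIn := by rw [row1_le, length_labels]
  have key : ∀ k, labels k 1 (p * q).word =
      labels k 1 p.word ++ RectTableau.shiftBy (3 * (le p).row1.length) (labels k 1 q.word) := by
    intro k
    rw [word_mul, labels_append, add_comm, labels_add, length_word, hl, RectTableau.shiftBy]
  change le (p * q) = RectTableau.mul (le p) (le q)
  ext1 <;> simp only [RectTableau.mul, row1_le, row2_le, row3_le] <;> rw [key, row1_le]

theorem le_bijective : Function.Bijective le := by
  constructor
  · intro p q h
    refine word_injective (eq_of_labels_eq 1 _ _ fun k => ?_)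
    cases k
    · rw [← row1_le, h, row1_le]
    · rw [← row2_le, h, row2_le]
    · rw [← row3_le, h, row3_le]
  · intro T
    obtain ⟨w, h1, h2, h3⟩ := T.exists_labels_eq
    obtain ⟨p, rfl⟩ := exists_word_eq (T.isWord_of_labels_eq h1 h2 h3)
    refine ⟨p, ?_⟩
    ext1
    · rw [row1_le, h1]
    · rw [row2_le, h2]
    · rw [row3_le, h3]

/-- `le` as an isomorphism of monoids. -/
noncomputable def leEquiv : Prograph ≃* RectTableau :=
  MulEquiv.ofBijective (⟨le, le_mul⟩ : Prograph →ₙ* RectTableau) le_bijective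

theorem PC_eq (n : ℕ) : PC n = {p | p.numCop = n} := by
  ext p
  simp [PC, numProd_eq_numCop]

end Prograph

namespace RectTableau

theorem ST_eq (n : ℕ) : ST n = {T | T.row1.length = n} := by
  ext T
  simp [ST, ← T.col23.length_eq, ← T.col12.length_eq]

end RectTableau

/-! ### Compatibility of the bijection with degrees -/

namespace Prograph

theorem length_row1_le (p : Prograph) : (le p).row1.length = p.numCop := by
  rw [row1_le, length_labels, numCop_eq_count]

theorem le_bijOn (n : ℕ) : Set.BijOn le (PC n) (RectTableau.ST n) := by
  rw [PC_eq, RectTableau.ST_eq]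
  refine ⟨fun p hp => (length_row1_le p).trans hp, le_bijective.1.injOn, fun T hT => ?_⟩
  obtain ⟨p, rfl⟩ := le_bijective.2 T
  exact ⟨p, (length_row1_le p).symm.trans hT, rfl⟩

theorem numCop_mul (p q : Prograph) : (p * q).numCop = p.numCop + q.numCop := by
  rw [numCop_eq_count, word_mul, List.count_append, ← numCop_eq_count, ← numCop_eq_count]

theorem eq_one_of_numCop_eq_zero {p : Prograph} (h : p.numCop = 0) : p = 1 := by
  refine word_injective ?_
  rw [word_one, ← List.length_eq_zero_iff, length_word, ← numCop_eq_count, h]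

end Prograph

/-! ### Freeness of the monoids -/

/-- A grading `d` of a left cancellative monoid with trivial part of degree `0`, which satisfies
Levi's lemma; such a monoid is free on its irreducible elements. -/
structure IsLeviGraded {M : Type*} [Monoid M] (d : M → ℕ) : Prop where
  map_mul : ∀ x y, d (x * y) = d x + d y
  eq_one : ∀ x, d x = 0 → x = 1
  left_cancel : ∀ x y z : M, x * y = x * z → y = z
  levi : ∀ x y z w : M, x * y = z * w → (∃ t, x = z * t) ∨ ∃ t, z = x * t

namespace IsLeviGraded

variable {M N : Type*} [Monoid M] [Monoid N] {d : M → ℕ}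

theorem map_one (h : IsLeviGraded d) : d 1 = 0 := by
  have h1 := h.map_mul 1 1
  rw [mul_one] at h1
  omega

theorem isUnit_iff (h : IsLeviGraded d) {x : M} : IsUnit x ↔ x = 1 := by
  refine ⟨fun hx => ?_, fun hx => hx ▸ isUnit_one⟩
  obtain ⟨y, hy⟩ := hx.exists_right_inv
  have h1 := h.map_mul x y
  rw [hy, h.map_one] at h1
  exact h.eq_one x (by omega)

theorem eq_of_irreducible_eq_mul (h : IsLeviGraded d) {x y t : M} (hx : Irreducible x)
    (hy : Irreducible y) (ht : x = y * t) : x = y := by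
  rcases hx.isUnit_or_isUnit ht with h1 | h1
  · exact absurd h1 hy.not_isUnit
  · rw [ht, h.isUnit_iff.1 h1, mul_one]

theorem transport {d' : N → ℕ} (h : IsLeviGraded d) (e : M ≃* N) (hd : ∀ x, d' (e x) = d x) :
    IsLeviGraded d' where
  map_mul x y := by
    obtain ⟨x, rfl⟩ := e.surjective x
    obtain ⟨y, rfl⟩ := e.surjective y
    rw [← _root_.map_mul, hd, hd, hd, h.map_mul]
  eq_one x hx := by
    obtain ⟨x, rfl⟩ := e.surjective x
    rw [h.eq_one x ((hd x).symm.trans hx), _root_.map_one]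
  left_cancel x y z hxyz := by
    have h1 := congrArg e.symm hxyz
    rw [_root_.map_mul, _root_.map_mul] at h1
    exact e.symm.injective (h.left_cancel _ _ _ h1)
  levi x y z w hxyzw := by
    have h1 := congrArg e.symm hxyzw
    rw [_root_.map_mul, _root_.map_mul] at h1
    refine (h.levi _ _ _ _ h1).imp ?_ ?_ <;>
    · rintro ⟨t, ht⟩
      exact ⟨e t, e.symm.injective (by simpa using ht)⟩

theorem irreducible_induction (h : IsLeviGraded d) {P : M → Prop} (one : P 1)
    (mul : ∀ x y, Irreducible x → P y → P (x * y)) (x : M) : P x := by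
  -- The trailing factor `y` strengthens the induction on degree: for `x = a * b` the hypothesis is
  -- used for `b` before `y`, then for `a` before `b * y`.
  have key : ∀ (n : ℕ) (x : M), d x ≤ n → ∀ y, P y → P (x * y) := by
    intro n
    induction n with
    | zero => intro x hx y hy; rwa [h.eq_one x (by omega), one_mul]
    | succ n ih =>
      intro x hx y hy
      by_cases h1 : x = 1
      · rwa [h1, one_mul]
      by_cases hirr : Irreducible x
      · exact mul x y hirr hy
      rw [irreducible_iff] at hirr
      push Not at hirr
      obtain ⟨a, b, rfl, ha, hb⟩ := hirr (mt h.isUnit_iff.1 h1)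
      have h2 := h.map_mul a b
      have ha' : d a ≠ 0 := fun h0 => ha (h.isUnit_iff.2 (h.eq_one a h0))
      have hb' : d b ≠ 0 := fun h0 => hb (h.isUnit_iff.2 (h.eq_one b h0))
      rw [mul_assoc]
      exact ih a (by omega) _ (ih b (by omega) y hy)
  simpa using key (d x) x le_rfl 1 one

/-- If two products of irreducibles agree, Levi's lemma makes one leading factor a left divisor of
the other, so they are equal and cancel. Degrees ensure that factorizations into irreducibles exist.
-/
theorem lift_bijective (h : IsLeviGraded d) :
    Function.Bijective (FreeMonoid.lift (Subtype.val : {x : M // Irreducible x} → M)) := by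
  constructor
  · intro l
    induction l using FreeMonoid.inductionOn' with
    | one =>
      intro l' hl
      induction l' using FreeMonoid.inductionOn' with
      | one => rfl
      | of_mul y l' _ =>
        simp only [_root_.map_one, _root_.map_mul, FreeMonoid.lift_eval_of] at hl
        have h1 := h.map_mul y.1 (FreeMonoid.lift Subtype.val l')
        rw [← hl, h.map_one] at h1
        exact absurd (h.isUnit_iff.2 (h.eq_one y.1 (by omega))) y.2.not_isUnit
    | of_mul x l ih =>
      intro l' hl
      induction l' using FreeMonoid.inductionOn' with
      | one =>
        simp only [_root_.map_one, _root_.map_mul, FreeMonoid.lift_eval_of] at hl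
        have h1 := h.map_mul x.1 (FreeMonoid.lift Subtype.val l)
        rw [hl, h.map_one] at h1
        exact absurd (h.isUnit_iff.2 (h.eq_one x.1 (by omega))) x.2.not_isUnit
      | of_mul y l' _ =>
        simp only [_root_.map_mul, FreeMonoid.lift_eval_of] at hl
        have hxy : x = y := by
          refine Subtype.ext ?_
          rcases h.levi _ _ _ _ hl with ⟨t, ht⟩ | ⟨t, ht⟩
          · exact h.eq_of_irreducible_eq_mul x.2 y.2 ht
          · exact (h.eq_of_irreducible_eq_mul y.2 x.2 ht).symm
        subst hxy
        rw [ih (h.left_cancel _ _ _ hl)]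
  · intro x
    induction x using h.irreducible_induction with
    | one => exact ⟨1, _root_.map_one _⟩
    | mul x y hx hy =>
      obtain ⟨l, rfl⟩ := hy
      exact ⟨FreeMonoid.of ⟨x, hx⟩ * l, by simp⟩

theorem exists_monoidHom (h : IsLeviGraded d) (g : M → N) :
    ∃ f : M →* N, ∀ x, Irreducible x → f x = g x := by
  let e := MulEquiv.ofBijective _ h.lift_bijective
  refine ⟨(FreeMonoid.lift fun x : {x : M // Irreducible x} => g x).comp e.symm.toMonoidHom,
    fun x hx => ?_⟩
  have h1 : e.symm x = FreeMonoid.of ⟨x, hx⟩ := by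
    rw [MulEquiv.symm_apply_eq]
    simp [e]
  simp [h1]

end IsLeviGraded

/-- For lists, two factorizations of the same word differ by an overlap `t`; by closure under left
quotients `t` is again the word of a prograph. -/
theorem Prograph.isLeviGraded : IsLeviGraded Prograph.numCop where
  map_mul := numCop_mul
  eq_one _ := eq_one_of_numCop_eq_zero
  left_cancel x y z h := by
    have h1 := congrArg word h
    rw [word_mul, word_mul] at h1
    exact word_injective (List.append_cancel_left h1)
  levi x y z w h := by
    have key : ∀ (x z : Prograph) (t : List WireKind), x.word = z.word ++ t → ∃ t, x = z * t := by
      intro x z t ht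
      obtain ⟨p, hp⟩ := exists_word_eq (z.isWord_word.of_append (ht ▸ x.isWord_word))
      exact ⟨p, word_injective (by rw [word_mul, hp, ht])⟩
    have h1 := congrArg word h
    rw [word_mul, word_mul] at h1
    rcases List.append_eq_append_iff.1 h1 with ⟨t, ht, -⟩ | ⟨t, ht, -⟩
    · exact Or.inr (key _ _ t ht)
    · exact Or.inl (key _ _ t ht)

theorem RectTableau.isLeviGraded : IsLeviGraded fun T : RectTableau => T.row1.length :=
  Prograph.isLeviGraded.transport Prograph.leEquiv Prograph.length_row1_le

/-! ### Hopf algebra structures on monoid algebras of free monoids -/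

namespace MonAlg

variable {K M N : Type*} [Field K] [Monoid M] [Monoid N]

theorem of_one : of K (1 : M) = 1 := map_one (MonoidAlgebra.of K M)

theorem of_mul (x y : M) : of K (x * y) = of K x * of K y := map_mul (MonoidAlgebra.of K M) x y

/-! ### Universal property of the monoid algebra -/

section StandardAlgebra

variable [alg : Algebra K (MonAlg K M)]

theorem exists_basis (halg : alg = stdAlgebra K M) :
    ∃ b : Module.Basis M K (MonAlg K M), ⇑b = of K := by
  subst halg
  exact ⟨MonoidAlgebra.basis M K, funext fun m => MonoidAlgebra.basis_apply ..⟩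

theorem exists_algHom (halg : alg = stdAlgebra K M) {B : Type*} [Semiring B] [Algebra K B]
    (f : M →* B) : ∃ F : MonAlg K M →ₐ[K] B, ∀ m, F (of K m) = f m := by
  subst halg
  exact ⟨MonoidAlgebra.lift K B M f, MonoidAlgebra.lift_of f⟩

theorem linearMap_ext (halg : alg = stdAlgebra K M) {V : Type*} [AddCommMonoid V] [Module K V]
    {f g : MonAlg K M →ₗ[K] V} (h : ∀ m, f (of K m) = g (of K m)) : f = g := by
  obtain ⟨b, hb⟩ := exists_basis halg
  exact b.ext fun m => by rw [hb]; exact h m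

theorem algHom_ext (halg : alg = stdAlgebra K M) {d : M → ℕ} (hd : IsLeviGraded d) {B : Type*}
    [Semiring B] [Algebra K B] {f g : MonAlg K M →ₐ[K] B}
    (h : ∀ m, Irreducible m → f (of K m) = g (of K m)) : f = g := by
  refine AlgHom.toLinearMap_injective (linearMap_ext halg fun m => ?_)
  change f (of K m) = g (of K m)
  induction m using hd.irreducible_induction with
  | one => rw [of_one, map_one, map_one]
  | mul x y hx hy => rw [of_mul, map_mul, map_mul, h x hx, hy]

theorem exists_algHom_irreducible (halg : alg = stdAlgebra K M) {d : M → ℕ} (hd : IsLeviGraded d)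
    {B : Type*} [Semiring B] [Algebra K B] (f : M → B) :
    ∃ F : MonAlg K M →ₐ[K] B, ∀ m, Irreducible m → F (of K m) = f m := by
  obtain ⟨g, hg⟩ := hd.exists_monoidHom f
  obtain ⟨F, hF⟩ := exists_algHom halg g
  exact ⟨F, fun m hm => (hF m).trans (hg m hm)⟩

end StandardAlgebra

/-! ### Existence of the Hopf algebra structure -/

theorem exists_isPrimitivelyGenerated (K : Type*) [Field K] {d : M → ℕ} (hd : IsLeviGraded d) :
    ∃ H : HopfAlgebra K (MonAlg K M), IsPrimitivelyGenerated K M (H := H) := by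
  let alg : Algebra K (MonAlg K M) := stdAlgebra K M
  have halg : alg = stdAlgebra K M := rfl
  obtain ⟨Δ, hΔ⟩ := exists_algHom_irreducible halg hd
    fun m : M => of K m ⊗ₜ[K] (1 : MonAlg K M) + 1 ⊗ₜ[K] of K m
  obtain ⟨ε, hε⟩ := exists_algHom_irreducible halg hd fun _ : M => (0 : K)
  -- An antipode reverses products, so it is constructed as an algebra map to the opposite algebra.
  obtain ⟨F, hF⟩ := exists_algHom_irreducible halg hd
    fun m : M => MulOpposite.op ((-1 : K) • of K m)
  clear_value alg
  let S : MonAlg K M →ₗ[K] MonAlg K M :=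
    (MulOpposite.opLinearEquiv K).symm.toLinearMap ∘ₗ F.toLinearMap
  have hS : ∀ m, Irreducible m → S (of K m) = (-1 : K) • of K m := fun m hm => by
    simp [S, hF m hm]
  have hS1 : S 1 = 1 := by simp [S]
  have hSmul : ∀ x y, S (x * y) = S y * S x := fun x y => by simp [S]
  let B : Bialgebra K (MonAlg K M) := Bialgebra.ofAlgHom Δ ε
    (algHom_ext halg hd fun m hm => by
      simp [hΔ m hm, TensorProduct.add_tmul, TensorProduct.tmul_add,
        Algebra.TensorProduct.one_def, add_assoc])
    (algHom_ext halg hd fun m hm => by simp [hΔ m hm, hε m hm])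
    (algHom_ext halg hd fun m hm => by simp [hΔ m hm, hε m hm])
  -- The algebra carries only a semiring structure, so negatives are multiples by `-1`.
  have hneg : ∀ x : MonAlg K M, x + (-1 : K) • x = 0 := fun x => by
    rw [← one_smul K x, smul_smul, ← add_smul]; simp
  -- On `(m ⊗ 1 + 1 ⊗ m)(a ⊗ b)` the left convolution gives `-S(a) m b + S(a) m b`.
  have hl : ∀ m, Irreducible m → ∀ y : MonAlg K M ⊗[K] MonAlg K M,
      LinearMap.mul' K _ (S.rTensor _ (Δ (of K m) * y)) = 0 := by
    intro m hm y
    induction y with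
    | zero => simp
    | add x y hx hy => rw [mul_add, map_add, map_add, hx, hy, add_zero]
    | tmul a b =>
      simp only [hΔ m hm, add_mul, Algebra.TensorProduct.tmul_mul_tmul, one_mul, map_add,
        LinearMap.rTensor_tmul, LinearMap.mul'_apply, hSmul, hS m hm]
      rw [← mul_assoc, add_comm, mul_smul_comm, smul_mul_assoc, hneg]
  -- On the right the result is the commutator of `m` with the value at `y`. It vanishes later,
  -- because by induction that value is a scalar.
  have hr : ∀ m, Irreducible m → ∀ y : MonAlg K M ⊗[K] MonAlg K M,
      LinearMap.mul' K _ (S.lTensor _ (Δ (of K m) * y)) =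
        of K m * LinearMap.mul' K _ (S.lTensor _ y) +
          (-1 : K) • (LinearMap.mul' K _ (S.lTensor _ y) * of K m) := by
    intro m hm y
    induction y with
    | zero => simp
    | add x y hx hy =>
      simp only [mul_add, map_add, hx, hy, add_mul, smul_add]
      abel
    | tmul a b =>
      simp only [hΔ m hm, add_mul, Algebra.TensorProduct.tmul_mul_tmul, one_mul, map_add,
        LinearMap.lTensor_tmul, LinearMap.mul'_apply, hSmul, hS m hm]
      rw [mul_assoc, mul_assoc, mul_smul_comm, mul_smul_comm]
  suffices h : LinearMap.mul' K (MonAlg K M) ∘ₗ S.rTensor _ ∘ₗ Δ.toLinearMap =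
        Algebra.linearMap K _ ∘ₗ ε.toLinearMap ∧
      LinearMap.mul' K (MonAlg K M) ∘ₗ S.lTensor _ ∘ₗ Δ.toLinearMap =
        Algebra.linearMap K _ ∘ₗ ε.toLinearMap by
    let H : HopfAlgebra K (MonAlg K M) :=
      { B with
        antipode := S
        mul_antipode_rTensor_comul := h.1
        mul_antipode_lTensor_comul := h.2 }
    exact ⟨H, ⟨halg, hΔ⟩⟩
  refine ⟨linearMap_ext halg fun m => ?_, linearMap_ext halg fun m => ?_⟩
  · change LinearMap.mul' K _ (S.rTensor _ (Δ (of K m))) = algebraMap K _ (ε (of K m))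
    induction m using hd.irreducible_induction with
    | one => simp [of_one, Algebra.TensorProduct.one_def, hS1]
    | mul x y hx hy => rw [of_mul, map_mul Δ, map_mul ε, hl x hx, hε x hx, zero_mul, map_zero]
  · change LinearMap.mul' K _ (S.lTensor _ (Δ (of K m))) = algebraMap K _ (ε (of K m))
    induction m using hd.irreducible_induction with
    | one => simp [of_one, Algebra.TensorProduct.one_def, hS1]
    | mul x y hx hy =>
      rw [of_mul, map_mul Δ, map_mul ε, hr x hx, hy, hε x hx, zero_mul, map_zero,
        Algebra.commutes, hneg]

/-! ### Uniqueness of the Hopf algebra structure -/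

section Primitive

variable [H : HopfAlgebra K (MonAlg K M)]

/-- Applying the counit once more to the counit axiom gives `ε(m) + ε(m) = ε(m)` in the field, where
cancellation is available. -/
theorem counit_of_irreducible (h : IsPrimitivelyGenerated K M) {m : M} (hm : Irreducible m) :
    Coalgebra.counit (R := K) (of K m) = 0 := by
  have h1 := congrArg (fun x => Coalgebra.counit (R := K) (TensorProduct.lid K _ x))
    (Coalgebra.rTensor_counit_comul (R := K) (of K m))
  simpa [h.comul_of m hm] using h1

theorem antipode_of_irreducible (h : IsPrimitivelyGenerated K M) {m : M} (hm : Irreducible m) :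
    HopfAlgebra.antipode K (of K m) = (-1 : K) • of K m := by
  have h1 := HopfAlgebra.mul_antipode_rTensor_comul_apply (R := K) (of K m)
  rw [h.comul_of m hm, counit_of_irreducible h hm] at h1
  simp only [map_add, LinearMap.rTensor_tmul, LinearMap.mul'_apply, mul_one,
    HopfAlgebra.antipode_one, one_mul, map_zero] at h1
  have hneg : of K m + (-1 : K) • of K m = 0 := by
    rw [← one_smul K (of K m), smul_smul, ← add_smul]; simp
  calc
    _ = HopfAlgebra.antipode K (of K m) + (of K m + (-1 : K) • of K m) := by rw [hneg, add_zero]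
    _ = (-1 : K) • of K m := by rw [← add_assoc, h1, zero_add]

theorem comulAlgHom_eq (h : IsPrimitivelyGenerated K M) {d : M → ℕ} (hd : IsLeviGraded d)
    {Δ : MonAlg K M →ₐ[K] MonAlg K M ⊗[K] MonAlg K M}
    (hΔ : ∀ m, Irreducible m → Δ (of K m) = of K m ⊗ₜ[K] 1 + 1 ⊗ₜ[K] of K m) :
    Bialgebra.comulAlgHom K (MonAlg K M) = Δ :=
  algHom_ext h.algebra_eq hd fun m hm => (h.comul_of m hm).trans (hΔ m hm).symm

theorem counitAlgHom_eq (h : IsPrimitivelyGenerated K M) {d : M → ℕ} (hd : IsLeviGraded d)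
    {ε : MonAlg K M →ₐ[K] K} (hε : ∀ m, Irreducible m → ε (of K m) = 0) :
    Bialgebra.counitAlgHom K (MonAlg K M) = ε :=
  algHom_ext h.algebra_eq hd fun m hm => (counit_of_irreducible h hm).trans (hε m hm).symm

theorem antipodeAlgHomOp_eq (h : IsPrimitivelyGenerated K M) {d : M → ℕ} (hd : IsLeviGraded d)
    {F : MonAlg K M →ₐ[K] (MonAlg K M)ᵐᵒᵖ}
    (hF : ∀ m, Irreducible m → F (of K m) = MulOpposite.op ((-1 : K) • of K m)) :
    HopfAlgebra.antipodeAlgHomOp K (MonAlg K M) = F :=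
  algHom_ext h.algebra_eq hd fun m hm =>
    (congrArg MulOpposite.op (antipode_of_irreducible h hm)).trans (hF m hm).symm

end Primitive

/-- All structure maps are algebra maps, the antipode into the opposite algebra, so their values on
irreducibles fix them. The remaining fields are proofs. -/
theorem eq_of_isPrimitivelyGenerated {d : M → ℕ} (hd : IsLeviGraded d)
    {H H' : HopfAlgebra K (MonAlg K M)} (h : IsPrimitivelyGenerated K M (H := H))
    (h' : IsPrimitivelyGenerated K M (H := H')) : H = H' := by
  obtain @⟨@⟨@⟨a₁, @⟨⟨Δ₁, ε₁⟩, u1, u2, u3⟩, u4, u5, u6, u7⟩, S₁⟩, u8, u9⟩ := H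
  obtain @⟨@⟨@⟨a₂, @⟨⟨Δ₂, ε₂⟩, v1, v2, v3⟩, v4, v5, v6, v7⟩, S₂⟩, v8, v9⟩ := H'
  obtain rfl : a₁ = a₂ := (IsPrimitivelyGenerated.algebra_eq (H := _) h).trans
    (IsPrimitivelyGenerated.algebra_eq (H := _) h').symm
  have halg : a₁ = stdAlgebra K M := IsPrimitivelyGenerated.algebra_eq (H := _) h
  obtain ⟨Δ, hΔ⟩ := exists_algHom_irreducible halg hd
    fun m : M => of K m ⊗ₜ[K] (1 : MonAlg K M) + 1 ⊗ₜ[K] of K m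
  obtain ⟨ε, hε⟩ := exists_algHom_irreducible halg hd fun _ : M => (0 : K)
  obtain ⟨F, hF⟩ := exists_algHom_irreducible halg hd
    fun m : M => MulOpposite.op ((-1 : K) • of K m)
  obtain rfl : Δ₁ = Δ₂ := (congrArg AlgHom.toLinearMap (comulAlgHom_eq (H := _) h hd hΔ)).trans
    (congrArg AlgHom.toLinearMap (comulAlgHom_eq (H := _) h' hd hΔ)).symm
  obtain rfl : ε₁ = ε₂ := (congrArg AlgHom.toLinearMap (counitAlgHom_eq (H := _) h hd hε)).trans
    (congrArg AlgHom.toLinearMap (counitAlgHom_eq (H := _) h' hd hε)).symm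
  obtain rfl : S₁ = S₂ := LinearMap.ext fun x => MulOpposite.op_injective <|
    (DFunLike.congr_fun (antipodeAlgHomOp_eq (H := _) h hd hF) x).trans
      (DFunLike.congr_fun (antipodeAlgHomOp_eq (H := _) h' hd hF) x).symm
  rfl

/-! ### The grading by degree -/

theorem isInternal_spanOf [alg : Algebra K (MonAlg K M)] (halg : alg = stdAlgebra K M)
    (d : M → ℕ) : DirectSum.IsInternal fun n => spanOf K {m : M | d m = n} := by
  obtain ⟨b, hb⟩ := exists_basis halg
  -- The independence criterion requires additive inverses, which the scalar `-1` supplies.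
  let _ : AddCommGroup (MonAlg K M) := Module.addCommMonoidToAddCommGroup K
  refine (DirectSum.isInternal_submodule_iff_iSupIndep_and_iSup_eq_top _).2 ⟨?_, ?_⟩
  · intro i
    simp only [spanOf, ← Submodule.span_iUnion, ← Set.image_iUnion, ← hb]
    refine b.linearIndependent.disjoint_span_image ?_
    rw [Set.disjoint_left]
    intro m hm hm'
    obtain ⟨j, hj, hm'⟩ := Set.mem_iUnion₂.1 hm'
    exact hj (Eq.trans (Eq.symm hm') hm)
  · simp only [spanOf, ← Submodule.span_iUnion, ← Set.image_iUnion]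
    have h : (⋃ n, {m : M | d m = n}) = Set.univ := Set.eq_univ_of_forall fun m => by simp
    rw [h, Set.image_univ, ← hb, b.span_eq]

theorem of_mem_spanOf [Algebra K (MonAlg K M)] {s : Set M} {m : M} (hm : m ∈ s) :
    of K m ∈ spanOf K s := Submodule.subset_span ⟨m, hm, rfl⟩

theorem mul_mem_spanOf [Algebra K (MonAlg K M)] {s t u : Set M}
    (h : ∀ a ∈ s, ∀ b ∈ t, a * b ∈ u) {x y : MonAlg K M} (hx : x ∈ spanOf K s)
    (hy : y ∈ spanOf K t) : x * y ∈ spanOf K u := by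
  have h1 := Submodule.mul_mem_mul hx hy
  rw [spanOf, spanOf, Submodule.span_mul_span] at h1
  refine Submodule.span_mono ?_ h1
  rintro _ ⟨_, ⟨a, ha, rfl⟩, _, ⟨b, hb, rfl⟩, rfl⟩
  exact ⟨a * b, h a ha b hb, of_mul a b⟩

section Primitive

variable [H : HopfAlgebra K (MonAlg K M)]

/-- Both terms of the coproduct of an irreducible have its total degree, and total degrees add under
multiplication in the tensor square. -/
theorem comul_of_mem (h : IsPrimitivelyGenerated K M) {d : M → ℕ} (hd : IsLeviGraded d) (m : M) :
    Coalgebra.comul (R := K) (of K m) ∈ Submodule.span K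
      {x : MonAlg K M ⊗[K] MonAlg K M | ∃ a b : M, d a + d b = d m ∧ x = of K a ⊗ₜ of K b} := by
  induction m using hd.irreducible_induction with
  | one =>
    refine Submodule.subset_span ⟨1, 1, by simp [hd.map_one], ?_⟩
    rw [of_one, Bialgebra.comul_one, Algebra.TensorProduct.one_def]
  | mul m m' hm hm' =>
    have h1 : Coalgebra.comul (R := K) (of K m) ∈ Submodule.span K
        {x : MonAlg K M ⊗[K] MonAlg K M | ∃ a b : M, d a + d b = d m ∧ x = of K a ⊗ₜ of K b} := by
      rw [h.comul_of m hm]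
      refine add_mem (Submodule.subset_span ⟨m, 1, ?_, ?_⟩) (Submodule.subset_span ⟨1, m, ?_, ?_⟩) <;>
        simp [hd.map_one, of_one]
    have h2 := Submodule.mul_mem_mul h1 hm'
    rw [Submodule.span_mul_span] at h2
    rw [of_mul, Bialgebra.comul_mul]
    refine Submodule.span_mono ?_ h2
    rintro _ ⟨_, ⟨a, b, hab, rfl⟩, _, ⟨a', b', hab', rfl⟩, rfl⟩
    refine ⟨a * a', b * b', ?_, ?_⟩
    · rw [hd.map_mul, hd.map_mul, hd.map_mul]; omega
    · simp [of_mul]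

theorem isGradedHopfAlgebra (h : IsPrimitivelyGenerated K M) {d : M → ℕ} (hd : IsLeviGraded d) :
    IsGradedHopfAlgebra K (MonAlg K M) fun n => spanOf K {m : M | d m = n} where
  isInternal := isInternal_spanOf h.algebra_eq d
  one_mem := of_one (K := K) (M := M) ▸ of_mem_spanOf hd.map_one
  mul_mem i j x hx y hy := mul_mem_spanOf
    (fun a ha b hb => (hd.map_mul a b).trans (congrArg₂ (· + ·) ha hb)) hx hy
  comul_mem n x hx := by
    refine (Submodule.span_le (p := Submodule.comap Coalgebra.comul (⨆ ij ∈ _, _))).2 ?_ hx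
    rintro _ ⟨m, rfl, rfl⟩
    refine SetLike.mem_coe.2 (Submodule.mem_comap.2 (Submodule.span_le.2 ?_ (comul_of_mem h hd m)))
    rintro _ ⟨a, b, hab, rfl⟩
    refine Submodule.mem_iSup_of_mem (d a, d b)
      (Submodule.mem_iSup_of_mem (Finset.HasAntidiagonal.mem_antidiagonal.2 hab) ?_)
    exact ⟨(⟨of K a, of_mem_spanOf rfl⟩ : spanOf K {m : M | d m = d a}) ⊗ₜ
      (⟨of K b, of_mem_spanOf rfl⟩ : spanOf K {m : M | d m = d b}), rfl⟩
  counit_eq_zero n hn x hx := by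
    refine (Submodule.span_le (p := LinearMap.ker Coalgebra.counit)).2 ?_ hx
    rintro _ ⟨m, rfl, rfl⟩
    induction m using hd.irreducible_induction with
    | one => exact absurd hd.map_one hn
    | mul m m' hm _ =>
      change Coalgebra.counit (R := K) (of K (m * m')) = 0
      rw [of_mul, Bialgebra.counit_mul, counit_of_irreducible h hm, zero_mul]
  antipode_mem n x hx := by
    refine (Submodule.span_le (p := Submodule.comap (HopfAlgebra.antipode K) (spanOf K _))).2 ?_ hx
    rintro _ ⟨m, rfl, rfl⟩
    change HopfAlgebra.antipode K (of K m) ∈ spanOf K {m' : M | d m' = d m}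
    clear hx
    induction m using hd.irreducible_induction with
    | one =>
      rw [of_one, HopfAlgebra.antipode_one, ← of_one]
      exact of_mem_spanOf rfl
    | mul m m' hm hm' =>
      rw [of_mul, HopfAlgebra.antipode_mul_antidistrib, antipode_of_irreducible h hm]
      refine mul_mem_spanOf (fun a ha b hb => ?_) hm'
        (Submodule.smul_mem _ _ (of_mem_spanOf (s := {x | d x = d m}) rfl))
      change d (a * b) = d (m * m')
      rw [hd.map_mul, hd.map_mul, show d a = d m' from ha, show d b = d m from hb, add_comm]

/-- Irreducibles correspond under `φ`, so the two coproducts and counits are compared on generators;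
the antipodes are compared by induction on irreducible factors. -/
theorem exists_bialgEquiv [HopfAlgebra K (MonAlg K N)] (hM : IsPrimitivelyGenerated K M)
    (hN : IsPrimitivelyGenerated K N) {d : M → ℕ} (hd : IsLeviGraded d) (φ : M ≃* N) :
    ∃ e : MonAlg K M ≃ₐc[K] MonAlg K N, (∀ m, e (of K m) = of K (φ m)) ∧
      ∀ x, e (HopfAlgebra.antipode K x) = HopfAlgebra.antipode K (e x) := by
  obtain ⟨f, hf⟩ := exists_algHom hM.algebra_eq (B := MonAlg K N)
    ((MonoidAlgebra.of K N : N →* MonAlg K N).comp φ.toMonoidHom)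
  obtain ⟨g, hg⟩ := exists_algHom hN.algebra_eq (B := MonAlg K M)
    ((MonoidAlgebra.of K M : M →* MonAlg K M).comp φ.symm.toMonoidHom)
  replace hf : ∀ m, f (of K m) = of K (φ m) := hf
  replace hg : ∀ m, g (of K m) = of K (φ.symm m) := hg
  have hgf : g.comp f = AlgHom.id K _ := algHom_ext hM.algebra_eq hd fun m _ => by simp [hf, hg]
  have hfg : f.comp g = AlgHom.id K _ := AlgHom.toLinearMap_injective <|
    linearMap_ext hN.algebra_eq fun m => by simp [hf, hg]
  have hφ : ∀ {m}, Irreducible m → Irreducible (φ m) := fun hm =>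
    (MulEquiv.irreducible_iff φ).2 hm
  refine ⟨BialgEquiv.ofAlgEquiv (AlgEquiv.ofAlgHom f g hfg hgf) ?_ ?_, hf, fun x => ?_⟩
  · refine algHom_ext hM.algebra_eq hd fun m hm => ?_
    simp [hf, counit_of_irreducible hM hm, counit_of_irreducible hN (hφ hm)]
  · refine algHom_ext hM.algebra_eq hd fun m hm => ?_
    simp [hf, hM.comul_of m hm, hN.comul_of _ (hφ hm)]
  · change f (HopfAlgebra.antipode K x) = HopfAlgebra.antipode K (f x)
    have key : f.toLinearMap ∘ₗ HopfAlgebra.antipode K = HopfAlgebra.antipode K ∘ₗ f.toLinearMap := by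
      refine linearMap_ext hM.algebra_eq fun m => ?_
      change f (HopfAlgebra.antipode K (of K m)) = HopfAlgebra.antipode K (f (of K m))
      induction m using hd.irreducible_induction with
      | one => simp [of_one]
      | mul m m' hm hm' =>
        simp only [of_mul, map_mul, HopfAlgebra.antipode_mul_antidistrib, hm', hf,
          antipode_of_irreducible hM hm, antipode_of_irreducible hN (hφ hm), map_smul]
    exact LinearMap.congr_fun key x

end Primitive

theorem existsUnique_isPrimitivelyGenerated (K : Type*) [Field K] {d : M → ℕ}
    (hd : IsLeviGraded d) :
    ∃! H : HopfAlgebra K (MonAlg K M), IsPrimitivelyGenerated K M (H := H) := by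
  obtain ⟨H, hH⟩ := exists_isPrimitivelyGenerated K hd
  exact ⟨H, hH, fun H' hH' => eq_of_isPrimitivelyGenerated hd hH' hH⟩

end MonAlg

/-! ### Assembly of the theorem -/

theorem mainTheorem3 (K : Type*) [Field K] :
    Function.Bijective Prograph.le ∧
    (∀ n : ℕ, Set.BijOn Prograph.le (Prograph.PC n) (RectTableau.ST n)) ∧
    (∃! H : HopfAlgebra K (MonAlg K Prograph),
      MonAlg.IsPrimitivelyGenerated K Prograph (H := H)) ∧
    (∃! H : HopfAlgebra K (MonAlg K RectTableau),
      MonAlg.IsPrimitivelyGenerated K RectTableau (H := H)) ∧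
    ∀ [HopfAlgebra K (MonAlg K Prograph)] [HopfAlgebra K (MonAlg K RectTableau)],
      MonAlg.IsPrimitivelyGenerated K Prograph →
      MonAlg.IsPrimitivelyGenerated K RectTableau →
      IsGradedHopfAlgebra K (MonAlg K Prograph) (fun n => MonAlg.spanOf K (Prograph.PC n)) ∧
      IsGradedHopfAlgebra K (MonAlg K RectTableau) (fun n => MonAlg.spanOf K (RectTableau.ST n)) ∧
      ∃ e : MonAlg K Prograph ≃ₐc[K] MonAlg K RectTableau,
        (∀ p : Prograph, e (MonAlg.of K p) = MonAlg.of K (Prograph.le p)) ∧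
        (∀ x : MonAlg K Prograph,
          e (HopfAlgebra.antipode K x) = HopfAlgebra.antipode K (e x)) ∧
        ∀ n : ℕ, (MonAlg.spanOf K (Prograph.PC n)).map
          (e : MonAlg K Prograph →ₗ[K] MonAlg K RectTableau) =
            MonAlg.spanOf K (RectTableau.ST n) := by
  refine ⟨Prograph.le_bijective, Prograph.le_bijOn,
    MonAlg.existsUnique_isPrimitivelyGenerated K Prograph.isLeviGraded,
    MonAlg.existsUnique_isPrimitivelyGenerated K RectTableau.isLeviGraded, ?_⟩
  intro _ _ hP hT
  obtain ⟨e, he, hS⟩ := MonAlg.exists_bialgEquiv hP hT Prograph.isLeviGraded Prograph.leEquiv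
  refine ⟨?_, ?_, e, he, hS, fun n => ?_⟩
  · simpa only [Prograph.PC_eq] using MonAlg.isGradedHopfAlgebra hP Prograph.isLeviGraded
  · simpa only [RectTableau.ST_eq] using MonAlg.isGradedHopfAlgebra hT RectTableau.isLeviGraded
  · rw [MonAlg.spanOf, MonAlg.spanOf, Submodule.map_span, ← (Prograph.le_bijOn n).image_eq,
      ← Set.image_comp, ← Set.image_comp]
    exact congrArg _ (Set.image_congr fun p _ => he p)
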